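/- All manifolds are smooth, Hausdorff, second countable and connected. *Null metric hypersurface data* $\{\mathcal H,\gamma,\ell,\ell^{(2)}\}$ consists of an $n$-dimensional manifold $\mathcal H$, a smooth symmetric $(0,2)$-tensor field $\gamma$, a smooth one-form $\ell$ and a smooth function $\ell^{(2)}$ such that at every $p$ the form $\mathcal A((X,a),(Y,b))=\gamma(X,Y)+a\,\ell(Y)+b\,\ell(X)+ab\,\ell^{(2)}$ on $T_p\mathcal H\times\mathbb R$ is nondegenerate and the scalar $n^{(2)}$ vanishes, where the vector field $n$ and the scalar $n^{(2)}$ are determined by $\gamma(n,\cdot)+n^{(2)}\ell=0$, $\ell(n)+n^{(2)}\ell^{(2)}=1$. *Abstract Killing horizon (AKH) data* $\mathfrak k=\{\mathcal H,\gamma,\ell,\ell^{(2)},\tau,\alpha\}$ is null metric hypersurface data with $\mathbf U=\tfrac12\mathcal L_n\gamma=0$, together with a smooth function $\alpha$ whose zero set has empty interior and a smooth one-form $\tau$ such that $\alpha\mathcal L_n\tau=n(\alpha)\tau-\tau(n)\,d\alpha$ and $\alpha^{-1}(\tau-d\alpha)$ extends smoothly to all of $\mathcal H$. Write $\bar\eta=\alpha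 n$. The data $\mathfrak k$ is *$(\Phi,\xi)$-embedded* in an $(n+1)$-dimensional semi-Riemannian manifold $(\mathcal M,g)$ with Levi-Civita connection $\nabla$ if $\Phi:\mathcal H\to\mathcal M$ is a smooth embedding, $\xi$ is a smooth vector field along $\Phi$ everywhere transverse to $\Phi(\mathcal H)$, $\Phi^\star g=\gamma$, $\Phi^\star(g(\xi,\cdot))=\ell$, $\Phi^\star(g(\xi,\xi))=\ell^{(2)}$, and $\nabla_{\Phi_\star X}\Phi_\star\bar\eta=\tau(X)\,\nu$ for every tangent vector $X$, where $\nu=\Phi_\star n$. *Gauge parameters* are a nowhere vanishing smooth function $z$ and a smooth vector field $V$ on $\mathcal H$, and $$\mathcal G_{(z,V)}\mathfrak k=\{\mathcal H,\ \gamma,\ z(\ell+\gamma(V,\cdot)),\ z^2(\ell^{(2)}+2\ell(V)+\gamma(V,V)),\ z\tau,\ z\alpha\}.$$ For a diffeomorphism $\chi:\mathcal H\to\mathcal H'$, put $\chi^\star\{\mathcal H',\gamma',\ell',\ell^{(2)\prime},\tau',\alpha'\}=\{\mathcal H,\chi^\star\gamma',\chi^\star\ell',\chi^\star\ell^{(2)\prime},\chi^\star\tau',\chi^\star\alpha'\}$.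 **Proposition.** Let $\mathfrak k=\{\mathcal H,\gamma,\ell,\ell^{(2)},\tau,\alpha\}$ be AKH data $(\Phi,\xi)$-embedded in $(\mathcal M,g)$ and let $\mathfrak k'=\{\mathcal H',\gamma',\ell',\ell^{(2)\prime},\tau',\alpha'\}$ be AKH data $(\Phi',\xi')$-embedded in $(\mathcal M',g')$. Let $\bar\eta=\alpha n$ and $\bar\eta'=\alpha' n'$. Assume that there is an isometry $\varphi:(\mathcal M,g)\to(\mathcal M',g')$ with $\varphi(\Phi(\mathcal H))=\Phi'(\mathcal H')$ and $\varphi_\star\Phi_\star\bar\eta=\Phi'_\star\bar\eta'$. Then there exist a diffeomorphism $\chi:\mathcal H\to\mathcal H'$ and gauge parameters $(z,V)$ such that $$\chi^\star\mathfrak k'=\mathcal G_{(z,V)}\mathfrak k .$$ -/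

import Mathlib

open scoped Manifold ContDiff

noncomputable section

/-! ### Tensor fields on a smooth manifold -/

section Fields

variable {d : ℕ} {N : Type*} [TopologicalSpace N] [ChartedSpace (EuclideanSpace ℝ (Fin d)) N]

instance tangentFinite (x : N) : FiniteDimensional ℝ (TangentSpace (𝓡 d) x) :=
  inferInstanceAs (FiniteDimensional ℝ (EuclideanSpace ℝ (Fin d)))

variable (d N) in
/-- A (not necessarily smooth) vector field. -/
abbrev VField : Type _ := ∀ x : N, TangentSpace (𝓡 d) x

variable (d N) in
/-- A (not necessarily smooth) one-form. -/
abbrev OneForm : Type _ := ∀ x : N, TangentSpace (𝓡 d) x →L[ℝ] ℝ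

variable (d N) in
/-- A (not necessarily smooth) covariant 2-tensor field. -/
abbrev TwoTensor : Type _ :=
  ∀ x : N, TangentSpace (𝓡 d) x →L[ℝ] TangentSpace (𝓡 d) x →L[ℝ] ℝ

/-- The Lie derivative of a one-form: `(L_Z θ)(X) = Z(θ(X)) - θ([Z, X])`. -/
def lieOneForm (Z : VField d N) (θ : OneForm d N) (X : VField d N) (x : N) : ℝ :=
  mvfderiv (𝓡 d) (fun y ↦ θ y (X y)) x (Z x) - θ x (VectorField.mlieBracket (𝓡 d) Z X x)

/-- The Lie derivative of a covariant 2-tensor field: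
`(L_Z B)(X, Y) = Z(B(X, Y)) - B([Z, X], Y) - B(X, [Z, Y])`. -/
def lieTwoTensor (Z : VField d N) (B : TwoTensor d N) (X Y : VField d N) (x : N) : ℝ :=
  mvfderiv (𝓡 d) (fun y ↦ B y (X y) (Y y)) x (Z x)
    - B x (VectorField.mlieBracket (𝓡 d) Z X x) (Y x)
    - B x (X x) (VectorField.mlieBracket (𝓡 d) Z Y x)

/-- The bilinear form `(v, w) ↦ B (A v) (A w)`. -/
def pullForm {V W : Type*} [AddCommGroup V] [Module ℝ V] [TopologicalSpace V]
    [IsTopologicalAddGroup V] [ContinuousSMul ℝ V] [AddCommGroup W] [Module ℝ W]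
    [TopologicalSpace W] [IsTopologicalAddGroup W] [ContinuousSMul ℝ W]
    (B : W →L[ℝ] W →L[ℝ] ℝ) (A : V →L[ℝ] W) : V →L[ℝ] V →L[ℝ] ℝ :=
  (ContinuousLinearMap.precomp ℝ A).comp (B.comp A)

theorem pullForm_apply {V W : Type*} [AddCommGroup V] [Module ℝ V] [TopologicalSpace V]
    [IsTopologicalAddGroup V] [ContinuousSMul ℝ V] [AddCommGroup W] [Module ℝ W]
    [TopologicalSpace W] [IsTopologicalAddGroup W] [ContinuousSMul ℝ W]
    (B : W →L[ℝ] W →L[ℝ] ℝ) (A : V →L[ℝ] W) (v w : V) :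
    pullForm B A v w = B (A v) (A w) := rfl

end Fields

section Smoothness

variable {d : ℕ} {N : Type*} [TopologicalSpace N] [ChartedSpace (EuclideanSpace ℝ (Fin d)) N]
  [IsManifold (𝓡 d) ∞ N]

/-- Smoothness of a vector field, as a section of the tangent bundle. -/
def VField.Smooth (X : VField d N) : Prop :=
  ContMDiff (𝓡 d) ((𝓡 d).prod 𝓘(ℝ, EuclideanSpace ℝ (Fin d))) ∞
    (fun x ↦ Bundle.TotalSpace.mk' (EuclideanSpace ℝ (Fin d))
      (E := fun x : N ↦ TangentSpace (𝓡 d) x) x (X x))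

/-- Smoothness of a one-form, as a section of the cotangent bundle. -/
def OneForm.Smooth (θ : OneForm d N) : Prop :=
  ContMDiff (𝓡 d) ((𝓡 d).prod 𝓘(ℝ, EuclideanSpace ℝ (Fin d) →L[ℝ] ℝ)) ∞
    (fun x ↦ Bundle.TotalSpace.mk' (EuclideanSpace ℝ (Fin d) →L[ℝ] ℝ)
      (E := fun x : N ↦ TangentSpace (𝓡 d) x →L[ℝ] ℝ) x (θ x))

/-- Smoothness of a covariant 2-tensor field, as a section of the bundle of bilinear forms. -/
def TwoTensor.Smooth (B : TwoTensor d N) : Prop :=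
  ContMDiff (𝓡 d)
    ((𝓡 d).prod 𝓘(ℝ, EuclideanSpace ℝ (Fin d) →L[ℝ] EuclideanSpace ℝ (Fin d) →L[ℝ] ℝ)) ∞
    (fun x ↦ Bundle.TotalSpace.mk'
      (EuclideanSpace ℝ (Fin d) →L[ℝ] EuclideanSpace ℝ (Fin d) →L[ℝ] ℝ)
      (E := fun x : N ↦ TangentSpace (𝓡 d) x →L[ℝ] TangentSpace (𝓡 d) x →L[ℝ] ℝ) x (B x))

end Smoothness

/-! ### Semi-Riemannian metrics and the Levi-Civita derivative along a map -/

/-- A smooth semi-Riemannian metric (of any signature). -/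
structure SemiRiemannianMetric (d : ℕ) (M : Type*) [TopologicalSpace M]
    [ChartedSpace (EuclideanSpace ℝ (Fin d)) M] [IsManifold (𝓡 d) ∞ M] where
  /-- The scalar product on each tangent space. -/
  val : TwoTensor d M
  symm : ∀ (x : M) (v w : TangentSpace (𝓡 d) x), val x v w = val x w v
  nondegenerate : ∀ (x : M) (v : TangentSpace (𝓡 d) x), (∀ w, val x v w = 0) → v = 0
  smooth : val.Smooth

section LeviCivita

variable {d : ℕ} {M : Type*} [TopologicalSpace M] [ChartedSpace (EuclideanSpace ℝ (Fin d)) M]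
  [IsManifold (𝓡 d) ∞ M]

/-- The map `v ↦ g(v, ·)` at a point is injective. -/
theorem SemiRiemannianMetric.flat_injective (g : SemiRiemannianMetric d M) (x : M) :
    Function.Injective
      ((ContinuousLinearMap.coeLM ℝ (M := TangentSpace (𝓡 d) x) (N₃ := ℝ)).comp
        (g.val x).toLinearMap) := by
  rw [← LinearMap.ker_eq_bot, LinearMap.ker_eq_bot']
  intro v hv
  exact g.nondegenerate x v fun w ↦ congrArg (fun f : TangentSpace (𝓡 d) x →ₗ[ℝ] ℝ ↦ f w) hv

/-- Raising an index: `g.sharp x f` is the vector `u` with `g(u, ·) = f`. -/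
def SemiRiemannianMetric.sharp (g : SemiRiemannianMetric d M) (x : M) :
    (TangentSpace (𝓡 d) x →ₗ[ℝ] ℝ) → TangentSpace (𝓡 d) x :=
  (LinearMap.linearEquivOfInjective _ (g.flat_injective x)
    Subspace.dual_finrank_eq.symm).symm

theorem SemiRiemannianMetric.val_sharp (g : SemiRiemannianMetric d M) (x : M)
    (f : TangentSpace (𝓡 d) x →ₗ[ℝ] ℝ) (w : TangentSpace (𝓡 d) x) :
    g.val x (g.sharp x f) w = f w :=
  congrArg (fun h : TangentSpace (𝓡 d) x →ₗ[ℝ] ℝ ↦ h w)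
    ((LinearMap.linearEquivOfInjective _ (g.flat_injective x)
      Subspace.dual_finrank_eq.symm).apply_symm_apply f)

/-- The derivative of the chart around `x₀`, at the point `x`. -/
def chartD (x₀ x : M) : TangentSpace (𝓡 d) x →L[ℝ] EuclideanSpace ℝ (Fin d) :=
  mvfderiv (𝓡 d) (extChartAt (𝓡 d) x₀) x

/-- The derivative of the inverse of the chart around `x₀`, at the coordinate value `y`. -/
def chartSymmD (x₀ : M) (y : EuclideanSpace ℝ (Fin d)) :
    EuclideanSpace ℝ (Fin d) →L[ℝ] TangentSpace (𝓡 d) ((extChartAt (𝓡 d) x₀).symm y) :=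
  (mfderiv 𝓘(ℝ, EuclideanSpace ℝ (Fin d)) (𝓡 d) (extChartAt (𝓡 d) x₀).symm y).comp
    (NormedSpace.fromTangentSpace y).symm.toContinuousLinearMap

/-- The metric in the coordinates given by the chart around `x₀` (the functions `g_{ij}`). -/
def SemiRiemannianMetric.inChart (g : SemiRiemannianMetric d M) (x₀ : M)
    (y : EuclideanSpace ℝ (Fin d)) :
    EuclideanSpace ℝ (Fin d) →L[ℝ] EuclideanSpace ℝ (Fin d) →L[ℝ] ℝ :=
  pullForm (g.val ((extChartAt (𝓡 d) x₀).symm y)) (chartSymmD x₀ y)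

/-- The Christoffel symbols of the first kind at `x₀`, in the chart around `x₀`:
`z ↦ (∂_u g(w, z) + ∂_w g(u, z) - ∂_z g(u, w)) / 2`. -/
def SemiRiemannianMetric.christoffelFirst (g : SemiRiemannianMetric d M) (x₀ : M)
    (u w : EuclideanSpace ℝ (Fin d)) : EuclideanSpace ℝ (Fin d) →L[ℝ] ℝ :=
  let D := fderiv ℝ (g.inChart x₀) (extChartAt (𝓡 d) x₀ x₀)
  (1 / 2 : ℝ) • (D u w + D w u - (D.flip u).flip w)

/-- The Christoffel symbols of the second kind at `x₀`, in the chart around `x₀`, as a tangent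
vector at `x₀` (the vector `Γ^k_{ij} u^i w^j ∂_k`). -/
def SemiRiemannianMetric.christoffel (g : SemiRiemannianMetric d M) (x₀ : M)
    (u w : EuclideanSpace ℝ (Fin d)) : TangentSpace (𝓡 d) x₀ :=
  g.sharp x₀ ((g.christoffelFirst x₀ u w).comp (chartD x₀ x₀)).toLinearMap

variable {n : ℕ} {S : Type*} [TopologicalSpace S] [ChartedSpace (EuclideanSpace ℝ (Fin n)) S]

/-- The Levi-Civita covariant derivative `∇_{Φ_* v} W` of a vector field `W` along a map
`Φ : S → M`, for `v` tangent to `S` at `p`. In the chart of `M` around `Φ p` it is given by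
`(v(W^k) + Γ^k_{ij} (Φ_* v)^i W^j) ∂_k`. -/
def SemiRiemannianMetric.covDerivAlong (g : SemiRiemannianMetric d M) (Φ : S → M)
    (W : ∀ q : S, TangentSpace (𝓡 d) (Φ q)) (p : S) (v : TangentSpace (𝓡 n) p) :
    TangentSpace (𝓡 d) (Φ p) :=
  (chartD (Φ p) (Φ p)).inverse
      (mvfderiv (𝓡 n) (fun q ↦ chartD (Φ p) (Φ q) (W q)) p v)
    + g.christoffel (Φ p) (chartD (Φ p) (Φ p) (mfderiv (𝓡 n) (𝓡 d) Φ p v))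
        (chartD (Φ p) (Φ p) (W p))

end LeviCivita

/-! ### Hypersurface data and abstract Killing horizon data -/

/-- A tuple `{S, γ, ℓ, ℓ⁽²⁾, τ, α}` on an `n`-dimensional manifold `S`, with no conditions. -/
@[ext]
structure HorizonTuple (n : ℕ) (S : Type*) [TopologicalSpace S]
    [ChartedSpace (EuclideanSpace ℝ (Fin n)) S] where
  /-- the tensor `γ` -/
  gam : TwoTensor n S
  /-- the one-form `ℓ` -/
  ell : OneForm n S
  /-- the scalar `ℓ⁽²⁾` -/
  ell2 : S → ℝ
  /-- the one-form `τ` -/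
  tau : OneForm n S
  /-- the function `α` -/
  alpha : S → ℝ

namespace HorizonTuple

section Algebra

variable {n : ℕ} {S : Type*} [TopologicalSpace S] [ChartedSpace (EuclideanSpace ℝ (Fin n)) S]

/-- The bilinear form on `T_p S × ℝ` given by
`A((X, a), (Y, b)) = γ(X, Y) + a ℓ(Y) + b ℓ(X) + a b ℓ⁽²⁾`. -/
def ambientForm (k : HorizonTuple n S) (p : S) :
    (TangentSpace (𝓡 n) p × ℝ) →ₗ[ℝ] (TangentSpace (𝓡 n) p × ℝ) →ₗ[ℝ] ℝ :=
  LinearMap.mk₂ ℝ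
    (fun u w ↦ k.gam p u.1 w.1 + u.2 * k.ell p w.1 + w.2 * k.ell p u.1 + u.2 * w.2 * k.ell2 p)
    (by intro u u' w; simp; ring) (by intro c u w; simp; ring)
    (by intro u w w'; simp; ring) (by intro c u w; simp; ring)

/-- The pair `(n, n⁽²⁾)` of contravariant data: the unique element of `T_p S × ℝ` with
`A((n, n⁽²⁾), (Y, b)) = b` for all `(Y, b)`, that is, `γ(n, ·) + n⁽²⁾ ℓ = 0` and
`ℓ(n) + n⁽²⁾ ℓ⁽²⁾ = 1`. (It is only used when `A` is nondegenerate.) -/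
def normalPair (k : HorizonTuple n S) (p : S) : TangentSpace (𝓡 n) p × ℝ :=
  open Classical in
  if h : (k.ambientForm p).Nondegenerate then
    (LinearMap.BilinForm.toDual (k.ambientForm p) h).symm (LinearMap.snd ℝ _ _)
  else 0

/-- The vector field `n`. -/
def normal (k : HorizonTuple n S) : VField n S := fun p ↦ (k.normalPair p).1

/-- The scalar `n⁽²⁾`. -/
def normal2 (k : HorizonTuple n S) (p : S) : ℝ := (k.normalPair p).2

/-- The vector field `α n`. -/
def etaBar (k : HorizonTuple n S) : VField n S := fun p ↦ k.alpha p • k.normal p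

/-- The gauge-transformed tuple. -/
def gauge (k : HorizonTuple n S) (z : S → ℝ) (V : VField n S) : HorizonTuple n S where
  gam := k.gam
  ell p := z p • (k.ell p + k.gam p (V p))
  ell2 p := z p ^ 2 * (k.ell2 p + 2 * k.ell p (V p) + k.gam p (V p) (V p))
  tau p := z p • k.tau p
  alpha p := z p * k.alpha p

/-- The pull-back of a tuple on `S'` by a map `S → S'`. -/
def pullback {S' : Type*} [TopologicalSpace S'] [ChartedSpace (EuclideanSpace ℝ (Fin n)) S']
    (χ : S → S') (k' : HorizonTuple n S') : HorizonTuple n S where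
  gam p := pullForm (k'.gam (χ p)) (mfderiv (𝓡 n) (𝓡 n) χ p)
  ell p := (k'.ell (χ p)).comp (mfderiv (𝓡 n) (𝓡 n) χ p)
  ell2 p := k'.ell2 (χ p)
  tau p := (k'.tau (χ p)).comp (mfderiv (𝓡 n) (𝓡 n) χ p)
  alpha p := k'.alpha (χ p)

end Algebra

section Geometry

variable {n : ℕ} {S : Type*} [TopologicalSpace S] [ChartedSpace (EuclideanSpace ℝ (Fin n)) S]
  [IsManifold (𝓡 n) ∞ S]

/-- `{S, γ, ℓ, ℓ⁽²⁾}` is null metric hypersurface data. -/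
structure IsNullMetricData (k : HorizonTuple n S) : Prop where
  gam_smooth : k.gam.Smooth
  ell_smooth : k.ell.Smooth
  ell2_smooth : ContMDiff (𝓡 n) 𝓘(ℝ, ℝ) ∞ k.ell2
  gam_symm : ∀ (p : S) (X Y : TangentSpace (𝓡 n) p), k.gam p X Y = k.gam p Y X
  nondegenerate : ∀ p, (k.ambientForm p).Nondegenerate
  null : ∀ p, k.normal2 p = 0

/-- The tensor `U = (1/2) L_n γ` of null metric hypersurface data. -/
def tensorU (k : HorizonTuple n S) (X Y : VField n S) (p : S) : ℝ :=
  (1 / 2) * lieTwoTensor k.normal k.gam X Y p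

/-- Abstract Killing horizon data. -/
structure IsAKHData (k : HorizonTuple n S) : Prop where
  nullData : k.IsNullMetricData
  U_eq_zero : ∀ X Y : VField n S, X.Smooth → Y.Smooth → ∀ p, k.tensorU X Y p = 0
  alpha_smooth : ContMDiff (𝓡 n) 𝓘(ℝ, ℝ) ∞ k.alpha
  alpha_zeros : interior {p | k.alpha p = 0} = ∅
  tau_smooth : k.tau.Smooth
  /-- `α L_n τ = n(α) τ - τ(n) dα` -/
  lie_tau : ∀ X : VField n S, X.Smooth → ∀ p,
    k.alpha p * lieOneForm k.normal k.tau X p =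
      mvfderiv (𝓡 n) k.alpha p (k.normal p) * k.tau p (X p)
        - k.tau p (k.normal p) * mvfderiv (𝓡 n) k.alpha p (X p)
  /-- `α⁻¹ (τ - dα)` extends smoothly to all of `S` -/
  extends_smoothly : ∃ σ : OneForm n S, σ.Smooth ∧
    ∀ p, k.alpha p ≠ 0 → σ p = (k.alpha p)⁻¹ • (k.tau p - mvfderiv (𝓡 n) k.alpha p)

variable {M : Type*} [TopologicalSpace M] [ChartedSpace (EuclideanSpace ℝ (Fin (n + 1))) M]
  [IsManifold (𝓡 (n + 1)) ∞ M]

/-- The tuple is `(Φ, ξ)`-embedded in `(M, g)`: `Φ` is an embedding, the rigging `ξ` is a smooth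
vector field along `Φ`, everywhere transverse to `Φ(S)`, the tensors `γ`, `ℓ`, `ℓ⁽²⁾` are induced
from `g`, and `∇_{Φ_* X} Φ_*(α n) = τ(X) ν`, where `ν = Φ_* n` is the null normal along `Φ(S)` with
`g(ν, ξ) = 1`. -/
structure IsEmbeddedIn (k : HorizonTuple n S) (g : SemiRiemannianMetric (n + 1) M)
    (Φ : S → M) (ξ : ∀ p : S, TangentSpace (𝓡 (n + 1)) (Φ p)) : Prop where
  embedding : Manifold.IsSmoothEmbedding (𝓡 n) (𝓡 (n + 1)) ∞ Φ
  rigging_smooth : ContMDiff (𝓡 n) (𝓡 (n + 1)).tangent ∞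
    (fun p ↦ (⟨Φ p, ξ p⟩ : TangentBundle (𝓡 (n + 1)) M))
  transverse : ∀ p, ξ p ∉ Set.range (mfderiv (𝓡 n) (𝓡 (n + 1)) Φ p)
  gam_eq : ∀ p, k.gam p = pullForm (g.val (Φ p)) (mfderiv (𝓡 n) (𝓡 (n + 1)) Φ p)
  ell_eq : ∀ p, k.ell p = (g.val (Φ p) (ξ p)).comp (mfderiv (𝓡 n) (𝓡 (n + 1)) Φ p)
  ell2_eq : ∀ p, k.ell2 p = g.val (Φ p) (ξ p) (ξ p)
  cov_eta : ∀ (p : S) (X : TangentSpace (𝓡 n) p),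
    g.covDerivAlong Φ (fun q ↦ mfderiv (𝓡 n) (𝓡 (n + 1)) Φ q (k.etaBar q)) p X =
      k.tau p X • mfderiv (𝓡 n) (𝓡 (n + 1)) Φ p (k.normal p)

end Geometry

end HorizonTuple

/-- A diffeomorphism is an isometry of semi-Riemannian manifolds. -/
def IsSemiRiemannianIsometry {d : ℕ} {M M' : Type*}
    [TopologicalSpace M] [ChartedSpace (EuclideanSpace ℝ (Fin d)) M] [IsManifold (𝓡 d) ∞ M]
    [TopologicalSpace M'] [ChartedSpace (EuclideanSpace ℝ (Fin d)) M'] [IsManifold (𝓡 d) ∞ M']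
    (g : SemiRiemannianMetric d M) (g' : SemiRiemannianMetric d M')
    (φ : M ≃ₘ^∞⟮𝓡 d, 𝓡 d⟯ M') : Prop :=
  ∀ x, pullForm (g'.val (φ x)) (mfderiv (𝓡 d) (𝓡 d) φ x) = g.val x

end

/-! The isometry restricts to a diffeomorphism `χ` with `φ ∘ Φ = Φ' ∘ χ`
(`Diffeomorph.exists_restrict`), and `χ` pulls `γ'` back to `γ`. For null data the radical of `γ` is
the line spanned by `n`, on which `ℓ` does not vanish. Hence `dχ(n) = z n'` with `z = ℓ'(dχ(n))`
nowhere zero, and this `z` is the first gauge parameter.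

Once `γ` is fixed, the remaining metric data are pure gauge (`exists_gauge`). The one-form `z⁻¹
χ^*ℓ' - ℓ` kills `n`, so it equals `γ(V, ·)` for some `V`, unique up to multiples of `n`; adding a
multiple of `n` changes `ℓ(V)` but not `γ(V, ·)`, and this freedom is used to match `ℓ⁽²⁾`.

Comparing `dχ(α n) = α' n'` with `dχ(n) = z n'` gives `χ^*α' = z α`. For `τ`, the Levi-Civita
derivative along a map is natural under isometries
(`IsSemiRiemannianIsometry.mfderiv_covDerivAlong`), so `dφ` carries `τ(X) ν` to `τ'(dχ X) ν'`,
whence `χ^*τ' = z τ`. As the connection is defined by Christoffel symbols in charts, naturality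
rests on their transformation law (`IsSemiRiemannianIsometry.mfderiv_christoffel`). -/

noncomputable section

/-! ### Smooth pairings and local frames. -/

section SmoothPairing

variable {d : ℕ} {N : Type*} [TopologicalSpace N] [ChartedSpace (EuclideanSpace ℝ (Fin d)) N]
  [IsManifold (𝓡 d) ∞ N]
  {m : ℕ} {Q : Type*} [TopologicalSpace Q] [ChartedSpace (EuclideanSpace ℝ (Fin m)) Q]

/-- Smooth one-forms applied to smooth vector fields along a smooth map are smooth. -/
theorem OneForm.Smooth.contMDiffAt_apply {θ : OneForm d N} (hθ : θ.Smooth) {b : Q → N}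
    {v : ∀ q, TangentSpace (𝓡 d) (b q)} {q₀ : Q} (hb : ContMDiffAt (𝓡 m) (𝓡 d) ∞ b q₀)
    (hv : ContMDiffAt (𝓡 m) (𝓡 d).tangent ∞
      (fun q ↦ (⟨b q, v q⟩ : TangentBundle (𝓡 d) N)) q₀) :
    ContMDiffAt (𝓡 m) 𝓘(ℝ, ℝ) ∞ (fun q ↦ θ (b q) (v q)) q₀ := by
  have h : ContMDiffAt (𝓡 m) ((𝓡 d).prod 𝓘(ℝ, ℝ)) ∞
      (fun q ↦ Bundle.TotalSpace.mk' ℝ (E := Bundle.Trivial N ℝ) (b q) (θ (b q) (v q))) q₀ := by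
    apply ContMDiffAt.clm_bundle_apply (F₁ := EuclideanSpace ℝ (Fin d))
    · exact ContMDiffAt.comp q₀ hθ.contMDiffAt hb
    · exact hv
  exact (Bundle.contMDiffAt_totalSpace.mp h).2

/-- Smooth covariant 2-tensors applied to smooth vector fields are smooth. -/
theorem TwoTensor.Smooth.contMDiffAt_apply {B : TwoTensor d N} (hB : B.Smooth)
    {v w : VField d N} {q₀ : N}
    (hv : ContMDiffAt (𝓡 d) (𝓡 d).tangent ∞
      (fun q ↦ (⟨q, v q⟩ : TangentBundle (𝓡 d) N)) q₀)
    (hw : ContMDiffAt (𝓡 d) (𝓡 d).tangent ∞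
      (fun q ↦ (⟨q, w q⟩ : TangentBundle (𝓡 d) N)) q₀) :
    ContMDiffAt (𝓡 d) 𝓘(ℝ, ℝ) ∞ (fun q ↦ B q (v q) (w q)) q₀ := by
  have h : ContMDiffAt (𝓡 d) ((𝓡 d).prod 𝓘(ℝ, ℝ)) ∞
      (fun q ↦ Bundle.TotalSpace.mk' ℝ (E := Bundle.Trivial N ℝ) q (B q (v q) (w q))) q₀ := by
    apply ContMDiffAt.clm_bundle_apply₂ (F₁ := EuclideanSpace ℝ (Fin d))
      (F₂ := EuclideanSpace ℝ (Fin d))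
    · exact hB.contMDiffAt
    · exact hv
    · exact hw
  exact (Bundle.contMDiffAt_totalSpace.mp h).2

/-- The vector field with constant components `u` in the trivialization around `q₀`. -/
def frameField (q₀ : N) (u : EuclideanSpace ℝ (Fin d)) : VField d N := fun q ↦
  (trivializationAt (EuclideanSpace ℝ (Fin d)) (TangentSpace (𝓡 d) : N → Type _) q₀).symmL ℝ q u

theorem contMDiffAt_frameField (q₀ : N) (u : EuclideanSpace ℝ (Fin d)) :
    ContMDiffAt (𝓡 d) (𝓡 d).tangent ∞
      (fun q ↦ (⟨q, frameField q₀ u q⟩ : TangentBundle (𝓡 d) N)) q₀ := by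
  refine Bundle.contMDiffAt_totalSpace.mpr ⟨contMDiffAt_id, ?_⟩
  refine (contMDiffAt_const (c := u)).congr_of_eventuallyEq ?_
  -- `symmL` inverts the trivialization only over its base set, so the components are constant only
  -- near `q₀`.
  filter_upwards [(trivializationAt (EuclideanSpace ℝ (Fin d))
    (TangentSpace (𝓡 d) : N → Type _) q₀).open_baseSet.mem_nhds
      (FiberBundle.mem_baseSet_trivializationAt' q₀)] with q hq
  have := (trivializationAt (EuclideanSpace ℝ (Fin d))
    (TangentSpace (𝓡 d) : N → Type _) q₀).continuousLinearMapAt_symmL (R := ℝ) hq u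
  rwa [Bundle.Trivialization.continuousLinearMapAt_apply,
    Bundle.Trivialization.linearMapAt_apply, if_pos hq] at this

end SmoothPairing

/-- A map into continuous linear maps on a finite-dimensional space is smooth if its values on
vectors are. -/
theorem contMDiffAt_clm_of_apply {E H N V F : Type*} [NormedAddCommGroup E] [NormedSpace ℝ E]
    [TopologicalSpace H] {I : ModelWithCorners ℝ E H} [TopologicalSpace N] [ChartedSpace H N]
    [NormedAddCommGroup V] [NormedSpace ℝ V] [FiniteDimensional ℝ V]
    [NormedAddCommGroup F] [NormedSpace ℝ F] {r : ℕ∞ω} {f : N → V →L[ℝ] F} {q₀ : N}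
    (h : ∀ v, ContMDiffAt I 𝓘(ℝ, F) r (fun q ↦ f q v) q₀) :
    ContMDiffAt I 𝓘(ℝ, V →L[ℝ] F) r f q₀ := by
  let b := Module.finBasis ℝ V
  -- In a basis, `f q` is the sum of the fixed coordinate forms tensored with the values `f q (b
  -- i)`.
  have key : f = fun q ↦ ∑ i, ContinuousLinearMap.smulRightL ℝ V F
      (LinearMap.toContinuousLinearMap (b.coord i)) (f q (b i)) := by
    ext q v
    conv_lhs => rw [← b.sum_repr v, map_sum]
    simp [-Module.Basis.sum_repr]
  rw [key]
  refine contMDiffAt_finsetSum fun i _ ↦ ?_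
  exact (ContinuousLinearMap.contDiff _).contMDiff.contMDiffAt.comp q₀ (h (b i))

/-! ### The null normal: algebra and smoothness. -/

namespace HorizonTuple

variable {n : ℕ} {S : Type*} [TopologicalSpace S] [ChartedSpace (EuclideanSpace ℝ (Fin n)) S]

theorem ambientForm_apply (k : HorizonTuple n S) (p : S) (u w : TangentSpace (𝓡 n) p × ℝ) :
    k.ambientForm p u w =
      k.gam p u.1 w.1 + u.2 * k.ell p w.1 + w.2 * k.ell p u.1 + u.2 * w.2 * k.ell2 p := rfl

variable [IsManifold (𝓡 n) ∞ S]

/-- A solution of a nondegenerate smooth linear system `A((X, a), ·) = (θ, f)` is smooth. -/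
theorem IsNullMetricData.smooth_of_ambientForm {k : HorizonTuple n S} (hk : k.IsNullMetricData)
    {X : VField n S} {a f : S → ℝ} {θ : OneForm n S}
    (hX : ∀ p w, k.ambientForm p (X p, a p) w = θ p w.1 + w.2 * f p)
    (hθ : ∀ q₀ u, ContMDiffAt (𝓡 n) 𝓘(ℝ, ℝ) ∞ (fun q ↦ θ q (frameField q₀ u q)) q₀)
    (hf : ContMDiff (𝓡 n) 𝓘(ℝ, ℝ) ∞ f) : X.Smooth := by
  intro q₀
  let e := trivializationAt (EuclideanSpace ℝ (Fin n)) (TangentSpace (𝓡 n) : S → Type _) q₀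
  let T : ∀ q, EuclideanSpace ℝ (Fin n) × ℝ →ₗ[ℝ] TangentSpace (𝓡 n) q × ℝ := fun q ↦
    (e.symmL ℝ q).toLinearMap.prodMap LinearMap.id
  -- In the local frame the system becomes `A q x = Ω q` on a fixed space. Its solution `(A q)⁻¹ (Ω
  -- q)` is smooth because inversion is smooth at invertible operators.
  let A : S → (EuclideanSpace ℝ (Fin n) × ℝ) →L[ℝ] (EuclideanSpace ℝ (Fin n) × ℝ) →L[ℝ] ℝ :=
    fun q ↦ ((k.ambientForm q).compl₁₂ (T q) (T q)).toContinuousBilinearMap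
  let Ω : S → (EuclideanSpace ℝ (Fin n) × ℝ) →L[ℝ] ℝ := fun q ↦
    ((θ q).comp (e.symmL ℝ q)).coprod (ContinuousLinearMap.toSpanSingleton ℝ (f q))
  have hA : ContMDiffAt (𝓡 n) 𝓘(ℝ, (EuclideanSpace ℝ (Fin n) × ℝ) →L[ℝ] (EuclideanSpace ℝ (Fin n) × ℝ) →L[ℝ] ℝ) ∞ A q₀ := by
    refine contMDiffAt_clm_of_apply fun v ↦ contMDiffAt_clm_of_apply fun w ↦ ?_
    have h1 := hk.gam_smooth.contMDiffAt_apply (contMDiffAt_frameField q₀ v.1)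
      (contMDiffAt_frameField q₀ w.1)
    have h2 := hk.ell_smooth.contMDiffAt_apply contMDiffAt_id (contMDiffAt_frameField q₀ v.1)
    have h3 := hk.ell_smooth.contMDiffAt_apply contMDiffAt_id (contMDiffAt_frameField q₀ w.1)
    exact ((h1.add (contMDiffAt_const.mul h3)).add (contMDiffAt_const.mul h2)).add
      ((contMDiffAt_const (c := v.2 * w.2)).mul hk.ell2_smooth.contMDiffAt)
  have hΩ : ContMDiffAt (𝓡 n) 𝓘(ℝ, (EuclideanSpace ℝ (Fin n) × ℝ) →L[ℝ] ℝ) ∞ Ω q₀ := by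
    refine contMDiffAt_clm_of_apply fun v ↦ ?_
    exact (hθ q₀ v.1).add (contMDiffAt_const.mul hf.contMDiffAt)
  have hbase : ∀ᶠ q in nhds q₀, q ∈ e.baseSet :=
    e.open_baseSet.mem_nhds (FiberBundle.mem_baseSet_trivializationAt' q₀)
  have hinj : ∀ q ∈ e.baseSet, Function.Injective (A q) := by
    intro q hq
    rw [injective_iff_map_eq_zero]
    intro v hv
    have hT : ∀ u, k.ambientForm q (T q v) u = 0 := by
      intro u
      have := congrArg (fun L ↦ L (e.continuousLinearMapAt ℝ q u.1, u.2)) hv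
      have h2 : T q (e.continuousLinearMapAt ℝ q u.1, u.2) = u := by
        refine Prod.ext ?_ rfl
        exact e.symmL_continuousLinearMapAt (R := ℝ) hq u.1
      rw [← h2]
      exact this
    have h0 : T q v = 0 := (hk.nondegenerate q).1 _ hT
    have h1 : e.symmL ℝ q v.1 = 0 := congrArg Prod.fst h0
    have h2 : v.2 = 0 := congrArg Prod.snd h0
    refine Prod.ext ?_ h2
    have := e.continuousLinearMapAt_symmL (R := ℝ) hq v.1
    rw [← this, h1, map_zero]; rfl
  have hinv : ∀ q ∈ e.baseSet, (A q).IsInvertible := by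
    intro q hq
    have hfr : Module.finrank ℝ (EuclideanSpace ℝ (Fin n) × ℝ) =
        Module.finrank ℝ ((EuclideanSpace ℝ (Fin n) × ℝ) →L[ℝ] ℝ) := by
      rw [← LinearMap.toContinuousLinearMap.finrank_eq]
      exact Subspace.dual_finrank_eq.symm
    exact ⟨(LinearEquiv.ofInjectiveOfFinrankEq (A q).toLinearMap (hinj q hq)
      hfr).toContinuousLinearEquiv, ContinuousLinearMap.ext fun _ ↦ rfl⟩
  have hsol : ∀ q ∈ e.baseSet, (e.continuousLinearMapAt ℝ q (X q), a q) =
      (A q).inverse (Ω q) := by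
    intro q hq
    have h1 : A q (e.continuousLinearMapAt ℝ q (X q), a q) = Ω q := by
      refine ContinuousLinearMap.ext fun w ↦ ?_
      have h2 : T q (e.continuousLinearMapAt ℝ q (X q), a q) = (X q, a q) :=
        Prod.ext (e.symmL_continuousLinearMapAt (R := ℝ) hq (X q)) rfl
      change k.ambientForm q (T q (e.continuousLinearMapAt ℝ q (X q), a q)) (T q w) = _
      rw [h2, hX]
      rfl
    obtain ⟨B, hB⟩ := hinv q hq
    rw [← h1, ← hB]
    simp
  refine Bundle.contMDiffAt_totalSpace.mpr ⟨contMDiffAt_id, ?_⟩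
  have h3 : ContMDiffAt (𝓡 n) 𝓘(ℝ, EuclideanSpace ℝ (Fin n)) ∞
      (fun q ↦ ((A q).inverse (Ω q)).1) q₀ := by
    have h4 : ContMDiffAt (𝓡 n) 
        𝓘(ℝ, ((EuclideanSpace ℝ (Fin n) × ℝ) →L[ℝ] ℝ) →L[ℝ] EuclideanSpace ℝ (Fin n) × ℝ) ∞ (fun q ↦ (A q).inverse) q₀ :=
      ((hinv q₀ hbase.self_of_nhds).contDiffAt_map_inverse).contMDiffAt.comp q₀ hA
    exact (ContinuousLinearMap.contDiff (ContinuousLinearMap.fst ℝ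
      (EuclideanSpace ℝ (Fin n)) ℝ)).contMDiff.contMDiffAt.comp q₀ (h4.clm_apply hΩ)
  refine h3.congr_of_eventuallyEq ?_
  filter_upwards [hbase] with q hq
  rw [← hsol q hq, Bundle.Trivialization.continuousLinearMapAt_apply,
    Bundle.Trivialization.linearMapAt_apply, if_pos hq]

theorem ambientForm_normalPair {k : HorizonTuple n S} (hk : k.IsNullMetricData) (p : S)
    (w : TangentSpace (𝓡 n) p × ℝ) : k.ambientForm p (k.normal p, 0) w = w.2 := by
  -- Nullity enters here: the second component `n⁽²⁾` is zero.
  have h0 : (k.normal p, (0 : ℝ)) = k.normalPair p := Prod.ext rfl (hk.null p).symm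
  rw [h0, normalPair, dif_pos (hk.nondegenerate p)]
  exact LinearMap.BilinForm.apply_toDual_symm_apply ..

theorem gam_normal {k : HorizonTuple n S} (hk : k.IsNullMetricData) (p : S)
    (w : TangentSpace (𝓡 n) p) : k.gam p (k.normal p) w = 0 := by
  simpa [ambientForm_apply] using ambientForm_normalPair hk p (w, 0)

theorem ell_normal {k : HorizonTuple n S} (hk : k.IsNullMetricData) (p : S) :
    k.ell p (k.normal p) = 1 := by
  simpa [ambientForm_apply] using ambientForm_normalPair hk p (0, 1)

/-- The difference `v - n` is killed by both `γ` and `ℓ`, so `(v - n, 0)` lies in the kernel of the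
nondegenerate form. -/
theorem eq_normal_of {k : HorizonTuple n S} (hk : k.IsNullMetricData) (p : S)
    {v : TangentSpace (𝓡 n) p} (hv : ∀ w, k.gam p v w = 0) (hl : k.ell p v = 1) :
    v = k.normal p := by
  have h : (v - k.normal p, (0 : ℝ)) = 0 := by
    refine (hk.nondegenerate p).1 _ fun w ↦ ?_
    simp [ambientForm_apply, hv, hl, gam_normal hk, ell_normal hk]
  exact sub_eq_zero.mp (congrArg Prod.fst h)

theorem smooth_normal {k : HorizonTuple n S} (hk : k.IsNullMetricData) : k.normal.Smooth := by
  refine hk.smooth_of_ambientForm (a := 0) (f := 1) (θ := fun _ ↦ 0)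
    (fun p w ↦ ?_) (fun q₀ u ↦ ?_) contMDiff_const
  · simpa using ambientForm_normalPair hk p w
  · simpa using! contMDiffAt_const

end HorizonTuple

/-! ### Differentiating a pulled-back bilinear form. -/

/-- The derivative of the pull-back of a field of bilinear forms, in vector spaces. -/
theorem fderiv_pullForm_apply {E E' : Type*} [NormedAddCommGroup E] [NormedSpace ℝ E]
    [NormedAddCommGroup E'] [NormedSpace ℝ E'] {G : E → E →L[ℝ] E →L[ℝ] ℝ}
    {G' : E' → E' →L[ℝ] E' →L[ℝ] ℝ} {F : E → E'} {y : E} (hF : ContDiffAt ℝ 2 F y)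
    (hG : DifferentiableAt ℝ G y) (hG' : DifferentiableAt ℝ G' (F y))
    (h : ∀ᶠ x in nhds y, ∀ w z, G x w z = G' (F x) (fderiv ℝ F x w) (fderiv ℝ F x z))
    (u w z : E) :
    fderiv ℝ G y u w z =
      fderiv ℝ G' (F y) (fderiv ℝ F y u) (fderiv ℝ F y w) (fderiv ℝ F y z)
        + G' (F y) (fderiv ℝ (fderiv ℝ F) y u w) (fderiv ℝ F y z)
        + G' (F y) (fderiv ℝ F y w) (fderiv ℝ (fderiv ℝ F) y u z) := by
  have hF1 : HasFDerivAt F (fderiv ℝ F y) y := (hF.differentiableAt (by simp)).hasFDerivAt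
  have hF2 : HasFDerivAt (fderiv ℝ F) (fderiv ℝ (fderiv ℝ F) y) y :=
    ((hF.fderiv_right (m := 1) (by norm_num)).differentiableAt (by simp)).hasFDerivAt
  have hD (v : E) := hF2.clm_apply (hasFDerivAt_const v y)
  have h0 : HasFDerivAt (fun x ↦ G' (F x)) ((fderiv ℝ G' (F y)).comp (fderiv ℝ F y)) y := by
    have hg := hG'.hasFDerivAt
    exact HasFDerivAt.comp (g := G') (f := F) (g' := fderiv ℝ G' (F y)) y hg hF1
  have h1 := (h0.clm_apply (hD w)).clm_apply (hD z)
  have h2 := (hG.hasFDerivAt.clm_apply (hasFDerivAt_const w y)).clm_apply (hasFDerivAt_const z y)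
  -- Both sides of `h`, with `w` and `z` fixed, are the same function near `y`; the product rule on
  -- the right yields the two second-derivative terms.
  have h3 := h2.unique (h1.congr_of_eventuallyEq (h.mono fun x hx ↦ hx w z))
  have h4 := congrArg (fun L ↦ L u) h3
  simp at h4
  rw [h4]
  ring

/-! ### Chart derivatives and the metric in coordinates. -/

section Charts

variable {d : ℕ} {M : Type*} [TopologicalSpace M] [ChartedSpace (EuclideanSpace ℝ (Fin d)) M]
  [IsManifold (𝓡 d) ∞ M]

/-- The tangent space at `x` is identified with the model space through the preferred chart at `x`,
so that chart has identity derivative at its centre. -/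
theorem chartD_self (x : M) (v : TangentSpace (𝓡 d) x) : chartD x x v = v := by
  have := mfderiv_extChartAt_self (I := 𝓡 d) (x := x)
  exact congrArg (fun L ↦ L v) this

theorem chartD_eq_trivializationAt {x₀ x : M}
    (hx : x ∈ (chartAt (EuclideanSpace ℝ (Fin d)) x₀).source) (v : TangentSpace (𝓡 d) x) :
    chartD x₀ x v = (trivializationAt (EuclideanSpace ℝ (Fin d))
      (TangentSpace (𝓡 d) : M → Type _) x₀ ⟨x, v⟩).2 := by
  have h := congrArg (fun L ↦ L v)
    (TangentBundle.continuousLinearMapAt_trivializationAt (I := 𝓡 d) hx)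
  have h2 : x ∈ (trivializationAt (EuclideanSpace ℝ (Fin d))
      (TangentSpace (𝓡 d) : M → Type _) x₀).baseSet := hx
  simp only [Bundle.Trivialization.continuousLinearMapAt_apply,
    Bundle.Trivialization.linearMapAt_apply, if_pos h2] at h
  exact h.symm

theorem chartSymmD_eq_symmL {x₀ : M} {y : EuclideanSpace ℝ (Fin d)}
    (hy : y ∈ (extChartAt (𝓡 d) x₀).target) (v : EuclideanSpace ℝ (Fin d)) :
    chartSymmD x₀ y v = (trivializationAt (EuclideanSpace ℝ (Fin d))
      (TangentSpace (𝓡 d) : M → Type _) x₀).symm ((extChartAt (𝓡 d) x₀).symm y) v := by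
  have hx : (extChartAt (𝓡 d) x₀).symm y ∈ (chartAt (EuclideanSpace ℝ (Fin d)) x₀).source := by
    simpa using (extChartAt (𝓡 d) x₀).map_target hy
  have h := congrArg (fun L ↦ L v) (TangentBundle.symmL_trivializationAt (I := 𝓡 d) hx)
  have h2 : (extChartAt (𝓡 d) x₀).symm y ∈ (trivializationAt (EuclideanSpace ℝ (Fin d))
      (TangentSpace (𝓡 d) : M → Type _) x₀).baseSet := hx
  rw [(extChartAt (𝓡 d) x₀).right_inv hy, ModelWithCorners.range_eq_univ,
    mfderivWithin_univ] at h
  rw [← Bundle.Trivialization.symmL_apply (R := ℝ) _ h2]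
  exact h.symm

theorem chartSymmD_self (x : M) (v : EuclideanSpace ℝ (Fin d)) :
    (chartSymmD x (extChartAt (𝓡 d) x x) v : EuclideanSpace ℝ (Fin d)) = v := by
  have := mfderivWithin_range_extChartAt_symm (I := 𝓡 d) (x := x)
  rw [ModelWithCorners.range_eq_univ, mfderivWithin_univ] at this
  exact congrArg (fun L ↦ L v) this

/-- The metric at a point, as a bilinear form on the model space. -/
def SemiRiemannianMetric.model (g : SemiRiemannianMetric d M) (x : M) :
    EuclideanSpace ℝ (Fin d) →L[ℝ] EuclideanSpace ℝ (Fin d) →L[ℝ] ℝ := g.val x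

theorem SemiRiemannianMetric.inChart_self (g : SemiRiemannianMetric d M) (x : M)
    (u w : EuclideanSpace ℝ (Fin d)) :
    g.inChart x (extChartAt (𝓡 d) x x) u w = g.model x u w := by
  change g.model ((extChartAt (𝓡 d) x).symm (extChartAt (𝓡 d) x x))
    (chartSymmD x (extChartAt (𝓡 d) x x) u) (chartSymmD x (extChartAt (𝓡 d) x x) w) = _
  rw [chartSymmD_self, chartSymmD_self, extChartAt_to_inv]

/-- Near the centre, the coordinate metric is the smooth section `g.val` read in the bundle
trivialization and composed with the inverse chart. -/
theorem SemiRiemannianMetric.differentiableAt_inChart (g : SemiRiemannianMetric d M) (x₀ : M) :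
    DifferentiableAt ℝ (g.inChart x₀) (extChartAt (𝓡 d) x₀ x₀) := by
  have h1 := (Bundle.contMDiffAt_totalSpace.mp (g.smooth x₀)).2
  have hx : (extChartAt (𝓡 d) x₀).symm (extChartAt (𝓡 d) x₀ x₀) = x₀ := extChartAt_to_inv x₀
  have hs : ContMDiffAt 𝓘(ℝ, EuclideanSpace ℝ (Fin d)) (𝓡 d) ∞ (extChartAt (𝓡 d) x₀).symm
      (extChartAt (𝓡 d) x₀ x₀) :=
    (contMDiffOn_extChartAt_symm x₀).contMDiffAt (extChartAt_target_mem_nhds x₀)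
  have h2 := ContMDiffAt.comp_of_eq h1 hs hx
  refine (h2.contDiffAt.differentiableAt (by simp)).congr_of_eventuallyEq ?_
  filter_upwards [extChartAt_target_mem_nhds (I := 𝓡 d) x₀] with y hy
  ext v w
  have hb : (extChartAt (𝓡 d) x₀).symm y ∈ (trivializationAt (EuclideanSpace ℝ (Fin d))
      (TangentSpace (𝓡 d) : M → Type _) x₀).baseSet := by
    simpa using (extChartAt (𝓡 d) x₀).map_target hy
  have := inCoordinates_apply_eq₂ (𝕜 := ℝ) (E₁ := (TangentSpace (𝓡 d) : M → Type _))
    (E₂ := (TangentSpace (𝓡 d) : M → Type _)) (E₃ := Bundle.Trivial M ℝ) (v := v) (w := w)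
    (ϕ := g.val ((extChartAt (𝓡 d) x₀).symm y)) hb hb (F₃ := ℝ) (x₀ := x₀) (Set.mem_univ _)
  rw [← chartSymmD_eq_symmL hy, ← chartSymmD_eq_symmL hy] at this
  simp only [Bundle.Trivial.fiberBundle_trivializationAt',
    Bundle.Trivial.linearMapAt_trivialization] at this
  rw [Function.comp_apply, hom_trivializationAt_apply]
  exact this.symm

end Charts

/-! ### Derivatives with values in the model spaces. -/

section Model

variable {l m d : ℕ} {P : Type*} [TopologicalSpace P] [ChartedSpace (EuclideanSpace ℝ (Fin l)) P]
  {Q : Type*} [TopologicalSpace Q] [ChartedSpace (EuclideanSpace ℝ (Fin m)) Q]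
  {N : Type*} [TopologicalSpace N] [ChartedSpace (EuclideanSpace ℝ (Fin d)) N]

variable (m d) in
/-- The derivative of a map, as a linear map between the model spaces. -/
def mfderivModel (f : Q → N) (x : Q) :
    EuclideanSpace ℝ (Fin m) →L[ℝ] EuclideanSpace ℝ (Fin d) := mfderiv (𝓡 m) (𝓡 d) f x

theorem mfderivModel_congr {f f' : Q → N} {x : Q} (h : f =ᶠ[nhds x] f') :
    mfderivModel m d f x = mfderivModel m d f' x := h.mfderiv_eq

theorem mfderivModel_comp {f : Q → N} {h : P → Q} {x : P}
    (hf : MDifferentiableAt (𝓡 m) (𝓡 d) f (h x)) (hh : MDifferentiableAt (𝓡 l) (𝓡 m) h x) :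
    mfderivModel l d (f ∘ h) x = (mfderivModel m d f (h x)).comp (mfderivModel l m h x) :=
  mfderiv_comp x hf hh

/-- The chain rule for a commuting square. Model-space values give both sides the same type even
though `f (h x)` and `f' (h' x)` agree only propositionally. -/
theorem mfderivModel_comp_eq_comp {r : ℕ} {R : Type*} [TopologicalSpace R]
    [ChartedSpace (EuclideanSpace ℝ (Fin r)) R] {f : Q → N} {h : P → Q} {f' : R → N} {h' : P → R}
    {x : P} (hf : MDifferentiableAt (𝓡 m) (𝓡 d) f (h x))
    (hh : MDifferentiableAt (𝓡 l) (𝓡 m) h x) (hf' : MDifferentiableAt (𝓡 r) (𝓡 d) f' (h' x))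
    (hh' : MDifferentiableAt (𝓡 l) (𝓡 r) h' x) (hcomp : ∀ q, f (h q) = f' (h' q))
    (v : EuclideanSpace ℝ (Fin l)) :
    mfderivModel m d f (h x) (mfderivModel l m h x v) =
      mfderivModel r d f' (h' x) (mfderivModel l r h' x v) := by
  have h1 := mfderivModel_comp hf hh
  rw [show f ∘ h = f' ∘ h' from funext hcomp, mfderivModel_comp hf' hh'] at h1
  exact congrArg (fun L ↦ L v) h1.symm

theorem mfderivModel_vectorSpace (f : EuclideanSpace ℝ (Fin m) → EuclideanSpace ℝ (Fin d))
    (y : EuclideanSpace ℝ (Fin m)) : mfderivModel m d f y = fderiv ℝ f y := mfderiv_eq_fderiv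

end Model

/-! ### Isometries in charts and the Christoffel transformation law. -/

section Naturality

variable {d : ℕ} {M : Type*} [TopologicalSpace M] [ChartedSpace (EuclideanSpace ℝ (Fin d)) M]
  [IsManifold (𝓡 d) ∞ M] {M' : Type*} [TopologicalSpace M']
  [ChartedSpace (EuclideanSpace ℝ (Fin d)) M']

theorem mdifferentiableAt_extChartAt_symm {x₀ : M}
    {y : EuclideanSpace ℝ (Fin d)} (hy : y ∈ (extChartAt (𝓡 d) x₀).target) :
    MDifferentiableAt 𝓘(ℝ, EuclideanSpace ℝ (Fin d)) (𝓡 d) (extChartAt (𝓡 d) x₀).symm y :=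
  ((contMDiffOn_extChartAt_symm (n := ∞) x₀).contMDiffAt
    ((isOpen_extChartAt_target x₀).mem_nhds hy)).mdifferentiableAt (by simp)

/-- The map `φ` written in the charts around `x₀` and `x₀'`. -/
def chartMap (φ : M → M') (x₀ : M) (x₀' : M') (y : EuclideanSpace ℝ (Fin d)) :
    EuclideanSpace ℝ (Fin d) :=
  extChartAt (𝓡 d) x₀' (φ ((extChartAt (𝓡 d) x₀).symm y))

theorem contDiffAt_chartMap {φ : M → M'} (hφ : ContMDiff (𝓡 d) (𝓡 d) ∞ φ) {x₀ : M} {x₀' : M'}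
    (hx : φ x₀ = x₀') :
    ContDiffAt ℝ ∞ (chartMap φ x₀ x₀') (extChartAt (𝓡 d) x₀ x₀) := by
  subst hx
  have hs : ContMDiffAt 𝓘(ℝ, EuclideanSpace ℝ (Fin d)) (𝓡 d) ∞ (extChartAt (𝓡 d) x₀).symm
      (extChartAt (𝓡 d) x₀ x₀) :=
    (contMDiffOn_extChartAt_symm x₀).contMDiffAt (extChartAt_target_mem_nhds x₀)
  have h1 := hφ.contMDiffAt.comp (extChartAt (𝓡 d) x₀ x₀) hs
  have h2 : ContMDiffAt (𝓡 d) 𝓘(ℝ, EuclideanSpace ℝ (Fin d)) ∞ (extChartAt (𝓡 d) (φ x₀)) (φ x₀) :=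
    contMDiffAt_extChartAt
  exact (h2.comp_of_eq h1 (by simp)).contDiffAt

variable [IsManifold (𝓡 d) ∞ M']

theorem eventually_chartD_mfderiv {φ : M → M'} (hφ : ContMDiff (𝓡 d) (𝓡 d) ∞ φ) {x₀ : M}
    {x₀' : M'} (hx : φ x₀ = x₀') :
    ∀ᶠ x in nhds x₀, ∀ t : EuclideanSpace ℝ (Fin d),
      chartD x₀' (φ x) (mfderivModel d d φ x t) =
        fderiv ℝ (chartMap φ x₀ x₀') (extChartAt (𝓡 d) x₀ x) (chartD x₀ x t) := by
  have h1 : ∀ᶠ x in nhds x₀, DifferentiableAt ℝ (chartMap φ x₀ x₀') (extChartAt (𝓡 d) x₀ x) := by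
    refine (continuousAt_extChartAt x₀).eventually ?_
    exact (((contDiffAt_chartMap hφ hx).of_le (m := 1) (by exact_mod_cast le_top)).eventually
      (by simp)).mono fun y hy ↦ hy.differentiableAt (by simp)
  have h2 : ∀ᶠ x in nhds x₀, φ x ∈ (extChartAt (𝓡 d) x₀').source :=
    hφ.continuous.continuousAt.eventually_mem (hx ▸ extChartAt_source_mem_nhds _)
  have h3 : ∀ᶠ x in nhds x₀, x ∈ (extChartAt (𝓡 d) x₀).source := extChartAt_source_mem_nhds x₀
  filter_upwards [h1, h2, h3] with x hd hφx hxs t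
  have e : (extChartAt (𝓡 d) x₀') ∘ φ =ᶠ[nhds x]
      chartMap φ x₀ x₀' ∘ extChartAt (𝓡 d) x₀ := by
    filter_upwards [(isOpen_extChartAt_source x₀).mem_nhds hxs] with q hq
    simp only [Function.comp_apply, chartMap]
    rw [(extChartAt (𝓡 d) x₀).left_inv hq]
  rw [extChartAt_source] at hφx hxs
  have h := mfderivModel_congr (m := d) (d := d) e
  rw [mfderivModel_comp (mdifferentiableAt_extChartAt (I := 𝓡 d) hφx)
    (hφ.mdifferentiableAt (by simp)), mfderivModel_comp hd.mdifferentiableAt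
    (mdifferentiableAt_extChartAt (I := 𝓡 d) hxs), mfderivModel_vectorSpace] at h
  exact congrArg (fun L ↦ L t) h

theorem eventually_mfderiv_chartSymmD {φ : M → M'} (hφ : ContMDiff (𝓡 d) (𝓡 d) ∞ φ) {x₀ : M}
    {x₀' : M'} (hx : φ x₀ = x₀') :
    ∀ᶠ y in nhds (extChartAt (𝓡 d) x₀ x₀),
      φ ((extChartAt (𝓡 d) x₀).symm y) = (extChartAt (𝓡 d) x₀').symm (chartMap φ x₀ x₀' y) ∧
      ∀ t, mfderivModel d d φ ((extChartAt (𝓡 d) x₀).symm y) (chartSymmD x₀ y t) =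
        chartSymmD x₀' (chartMap φ x₀ x₀' y) (fderiv ℝ (chartMap φ x₀ x₀') y t) := by
  have h1 : ∀ᶠ y in nhds (extChartAt (𝓡 d) x₀ x₀),
      DifferentiableAt ℝ (chartMap φ x₀ x₀') y :=
    (((contDiffAt_chartMap hφ hx).of_le (m := 1) (by exact_mod_cast le_top)).eventually
      (by simp)).mono fun y hy ↦ hy.differentiableAt (by simp)
  -- The nested quantifier is needed because the identity `e` is differentiated at `y`, so it must
  -- hold on a neighbourhood of each such `y`.
  have h2 : ∀ᶠ y in nhds (extChartAt (𝓡 d) x₀ x₀), ∀ᶠ y in nhds y,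
      φ ((extChartAt (𝓡 d) x₀).symm y) ∈ (extChartAt (𝓡 d) x₀').source := by
    refine eventually_eventually_nhds.mpr ?_
    refine (hφ.continuous.continuousAt.comp (continuousAt_extChartAt_symm x₀)).eventually_mem ?_
    simp only [Function.comp_apply, extChartAt_to_inv, hx]
    exact extChartAt_source_mem_nhds _
  filter_upwards [h1, h2, extChartAt_target_mem_nhds x₀] with y hd hy hyt
  have e : φ ∘ (extChartAt (𝓡 d) x₀).symm =ᶠ[nhds y]
      (extChartAt (𝓡 d) x₀').symm ∘ chartMap φ x₀ x₀' := by
    filter_upwards [hy] with q hq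
    exact ((extChartAt (𝓡 d) x₀').left_inv hq).symm
  refine ⟨e.self_of_nhds, fun t ↦ ?_⟩
  have hyt' : chartMap φ x₀ x₀' y ∈ (extChartAt (𝓡 d) x₀').target :=
    (extChartAt (𝓡 d) x₀').map_source hy.self_of_nhds
  have h := mfderivModel_congr (m := d) (d := d) e
  rw [mfderivModel_comp (hφ.mdifferentiableAt (by simp)) (mdifferentiableAt_extChartAt_symm hyt), mfderivModel_comp
    (mdifferentiableAt_extChartAt_symm hyt') hd.mdifferentiableAt,
    mfderivModel_vectorSpace] at h
  exact congrArg (fun L ↦ L t) h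

variable {g : SemiRiemannianMetric d M} {g' : SemiRiemannianMetric d M'}
  {φ : M ≃ₘ^∞⟮𝓡 d, 𝓡 d⟯ M'}

theorem IsSemiRiemannianIsometry.eventually_inChart (hφ : IsSemiRiemannianIsometry g g' φ)
    {x₀ : M} {x₀' : M'} (hx : φ x₀ = x₀') :
    ∀ᶠ y in nhds (extChartAt (𝓡 d) x₀ x₀), ∀ w z, g.inChart x₀ y w z =
      g'.inChart x₀' (chartMap φ x₀ x₀' y) (fderiv ℝ (chartMap φ x₀ x₀') y w)
        (fderiv ℝ (chartMap φ x₀ x₀') y z) := by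
  filter_upwards [eventually_mfderiv_chartSymmD φ.contMDiff hx] with y hy w z
  have h1 : g.inChart x₀ y w z = g'.model (φ ((extChartAt (𝓡 d) x₀).symm y))
      (mfderivModel d d φ _ (chartSymmD x₀ y w)) (mfderivModel d d φ _ (chartSymmD x₀ y z)) :=
    congrArg (fun B ↦ B (chartSymmD x₀ y w) (chartSymmD x₀ y z)) (hφ _).symm
  rw [h1, hy.1, hy.2, hy.2]
  rfl

theorem fderiv_chartMap_eq_mfderiv {x₀ : M} {x₀' : M'} (hx : φ x₀ = x₀')
    (t : EuclideanSpace ℝ (Fin d)) :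
    fderiv ℝ (chartMap (d := d) φ x₀ x₀') (extChartAt (𝓡 d) x₀ x₀) t = mfderivModel d d φ x₀ t := by
  subst hx
  have h := (eventually_chartD_mfderiv φ.contMDiff (x₀ := x₀) rfl).self_of_nhds t
  exact ((chartD_self (φ x₀) _).symm.trans (h.trans
    (congrArg _ (chartD_self x₀ t)))).symm

/-- The Christoffel symbols of the second kind, with values in the model space. -/
def SemiRiemannianMetric.christoffelModel (g : SemiRiemannianMetric d M) (x₀ : M)
    (u w : EuclideanSpace ℝ (Fin d)) : EuclideanSpace ℝ (Fin d) := g.christoffel x₀ u w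

theorem SemiRiemannianMetric.model_christoffelModel (g : SemiRiemannianMetric d M) (x₀ : M)
    (u w t : EuclideanSpace ℝ (Fin d)) :
    g.model x₀ (g.christoffelModel x₀ u w) t = g.christoffelFirst x₀ u w t := by
  have h := g.val_sharp x₀ ((g.christoffelFirst x₀ u w).comp (chartD x₀ x₀)).toLinearMap t
  refine h.trans ?_
  exact congrArg (g.christoffelFirst x₀ u w) (chartD_self x₀ t)

/-- The transformation law of the Christoffel symbols under an isometry. -/
theorem IsSemiRiemannianIsometry.mfderiv_christoffel (hφ : IsSemiRiemannianIsometry g g' φ)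
    {x₀ : M} {x₀' : M'} (hx : φ x₀ = x₀') (u w : EuclideanSpace ℝ (Fin d)) :
    mfderivModel d d φ x₀ (g.christoffelModel x₀ u w) =
      g'.christoffelModel x₀' (mfderivModel d d φ x₀ u) (mfderivModel d d φ x₀ w) +
      fderiv ℝ (fderiv ℝ (chartMap (d := d) φ x₀ x₀')) (extChartAt (𝓡 d) x₀ x₀) u w := by
  set F := chartMap (d := d) φ x₀ x₀' with hF
  set y₀ := extChartAt (𝓡 d) x₀ x₀ with hy₀
  have hFy : F y₀ = extChartAt (𝓡 d) x₀' x₀' := by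
    simp [hF, hy₀, chartMap, hx]
  have hF2 : ContDiffAt ℝ 2 F y₀ :=
    (contDiffAt_chartMap φ.contMDiff hx).of_le (by norm_cast)
  have key := fderiv_pullForm_apply hF2 (g.differentiableAt_inChart x₀)
    (by rw [hFy]; exact g'.differentiableAt_inChart x₀') (hφ.eventually_inChart hx)
  have hsymm : ∀ a b, fderiv ℝ (fderiv ℝ F) y₀ a b = fderiv ℝ (fderiv ℝ F) y₀ b a := fun a b ↦
    (hF2.isSymmSndFDerivAt (by simp)).eq a b
  have hg'symm : ∀ a b, g'.model x₀' a b = g'.model x₀' b a := g'.symm x₀'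
  have hdF : ∀ t : EuclideanSpace ℝ (Fin d), mfderivModel d d φ x₀ t = fderiv ℝ F y₀ t :=
    fun t ↦ (fderiv_chartMap_eq_mfderiv hx t).symm
  rw [← sub_eq_zero]
  -- Testing against every `s = dF(t)` reduces the law to Christoffel symbols of the first kind,
  -- that is, to first derivatives of the metric.
  refine g'.nondegenerate x₀' _ fun s ↦ ?_
  obtain ⟨t, rfl⟩ : ∃ t : EuclideanSpace ℝ (Fin d), fderiv ℝ F y₀ t = s := by
    subst hx
    obtain ⟨t, ht⟩ := (φ.mfderivToContinuousLinearEquiv (by simp) x₀).surjective s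
    exact ⟨t, (fderiv_chartMap_eq_mfderiv rfl t).trans ht⟩
  change g'.model x₀' _ _ = 0
  have hiso : ∀ a b : EuclideanSpace ℝ (Fin d),
      g'.model x₀' (fderiv ℝ F y₀ a) (fderiv ℝ F y₀ b) = g.model x₀ a b := by
    intro a b
    rw [← g.inChart_self, (hφ.eventually_inChart hx).self_of_nhds, ← hF, ← hy₀, hFy,
      g'.inChart_self]
  rw [map_sub, map_add]
  simp only [sub_apply, add_apply]
  rw [hdF, hdF, hdF, hiso, g.model_christoffelModel, g'.model_christoffelModel]
  simp only [SemiRiemannianMetric.christoffelFirst, smul_apply,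
    sub_apply, add_apply, ContinuousLinearMap.flip_apply,
    smul_eq_mul]
  rw [← hy₀, key, key, key, hFy]
  simp only [g'.inChart_self]
  -- The three metric derivatives contribute six terms in `D²F`. By symmetry of `D²F` and of `g'`,
  -- four cancel and two coincide, leaving `g'(D²F(u, w), dF t)`.
  rw [hsymm w u, hsymm t u, hsymm t w, hg'symm (fderiv ℝ F y₀ w),
    hg'symm (fderiv ℝ F y₀ u) (fderiv ℝ (fderiv ℝ F) y₀ w t)]
  ring

end Naturality

/-! ### Naturality of the covariant derivative along a map. -/

section Naturality

variable {d : ℕ} {M : Type*} [TopologicalSpace M] [ChartedSpace (EuclideanSpace ℝ (Fin d)) M]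
  [IsManifold (𝓡 d) ∞ M] {M' : Type*} [TopologicalSpace M']
  [ChartedSpace (EuclideanSpace ℝ (Fin d)) M'] [IsManifold (𝓡 d) ∞ M']
  {n : ℕ} {S : Type*} [TopologicalSpace S] [ChartedSpace (EuclideanSpace ℝ (Fin n)) S]
  {S' : Type*} [TopologicalSpace S'] [ChartedSpace (EuclideanSpace ℝ (Fin n)) S']

theorem chartD_inverse_self (x : M) (v : EuclideanSpace ℝ (Fin d)) :
    (chartD x x).inverse v = v := by
  let C : EuclideanSpace ℝ (Fin d) →L[ℝ] EuclideanSpace ℝ (Fin d) := chartD x x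
  have h : C = ContinuousLinearMap.id ℝ _ := ContinuousLinearMap.ext (chartD_self x)
  have h2 : C.inverse v = v := by
    rw [h, ContinuousLinearMap.inverse_id]; rfl
  exact h2

/-- The components in the chart around `Φ p` of a field along `Φ`. -/
def chartComponents (Φ : S → M) (W : ∀ q : S, TangentSpace (𝓡 d) (Φ q)) (x₀ : M) (q : S) :
    EuclideanSpace ℝ (Fin d) := chartD x₀ (Φ q) (W q)

/-- The covariant derivative along a map, with values in the model space. -/
def SemiRiemannianMetric.covDerivModel (g : SemiRiemannianMetric d M) (Φ : S → M)
    (W : ∀ q : S, TangentSpace (𝓡 d) (Φ q)) (p : S) (v : EuclideanSpace ℝ (Fin n)) :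
    EuclideanSpace ℝ (Fin d) := g.covDerivAlong Φ W p v

theorem SemiRiemannianMetric.covDerivModel_eq (g : SemiRiemannianMetric d M) (Φ : S → M)
    (W : ∀ q : S, TangentSpace (𝓡 d) (Φ q)) (p : S) (v : EuclideanSpace ℝ (Fin n)) :
    g.covDerivModel Φ W p v = mfderivModel n d (chartComponents Φ W (Φ p)) p v +
      g.christoffelModel (Φ p) (mfderivModel n d Φ p v) (W p) := by
  have h1 := chartD_inverse_self (Φ p) (mfderivModel n d (chartComponents Φ W (Φ p)) p v)
  have h2 : g.christoffelModel (Φ p) (chartD (Φ p) (Φ p) (mfderivModel n d Φ p v))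
      (chartD (Φ p) (Φ p) (W p)) = g.christoffelModel (Φ p) (mfderivModel n d Φ p v) (W p) :=
    congrArg₂ _ (chartD_self _ _) (chartD_self _ _)
  exact congrArg₂ (fun a b : EuclideanSpace ℝ (Fin d) ↦ a + b) h1 h2

/-- Near `p` the chart components are the fibre coordinates of `W` in the tangent bundle
trivialization at `Φ p`. -/
theorem mdifferentiableAt_chartComponents {Φ : S → M} {W : ∀ q : S, TangentSpace (𝓡 d) (Φ q)}
    (h : ContMDiff (𝓡 n) (𝓡 d).tangent ∞ (fun q ↦ (⟨Φ q, W q⟩ : TangentBundle (𝓡 d) M))) (p : S) :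
    MDifferentiableAt (𝓡 n) 𝓘(ℝ, EuclideanSpace ℝ (Fin d)) (chartComponents Φ W (Φ p)) p := by
  have h1 := Bundle.contMDiffAt_totalSpace.mp (h p)
  refine (h1.2.mdifferentiableAt (by simp)).congr_of_eventuallyEq ?_
  filter_upwards [h1.1.continuousAt.eventually_mem
    ((chartAt (EuclideanSpace ℝ (Fin d)) (Φ p)).open_source.mem_nhds
      (mem_chart_source _ _))] with q hq
  exact chartD_eq_trivializationAt hq _

variable {g : SemiRiemannianMetric d M} {g' : SemiRiemannianMetric d M'}
  {φ : M ≃ₘ^∞⟮𝓡 d, 𝓡 d⟯ M'}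

/-- The Levi-Civita derivative along maps is preserved by isometries and reparametrizations. -/
theorem IsSemiRiemannianIsometry.mfderiv_covDerivAlong (hφ : IsSemiRiemannianIsometry g g' φ)
    {Φ : S → M} {W : ∀ q : S, TangentSpace (𝓡 d) (Φ q)} {Φ' : S' → M'}
    {W' : ∀ q : S', TangentSpace (𝓡 d) (Φ' q)} {χ : S → S'} {p : S}
    (hΦ : MDifferentiableAt (𝓡 n) (𝓡 d) Φ p) (hΦ' : MDifferentiableAt (𝓡 n) (𝓡 d) Φ' (χ p))
    (hχ : MDifferentiableAt (𝓡 n) (𝓡 n) χ p) (hcomp : ∀ q, φ (Φ q) = Φ' (χ q))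
    (hWW' : ∀ q, mfderivModel d d φ (Φ q) (W q) = W' (χ q))
    (hW : MDifferentiableAt (𝓡 n) 𝓘(ℝ, EuclideanSpace ℝ (Fin d)) (chartComponents Φ W (Φ p)) p)
    (hW' : MDifferentiableAt (𝓡 n) 𝓘(ℝ, EuclideanSpace ℝ (Fin d))
      (chartComponents Φ' W' (Φ' (χ p))) (χ p)) (v : EuclideanSpace ℝ (Fin n)) :
    mfderivModel d d φ (Φ p) (g.covDerivModel Φ W p v) =
      g'.covDerivModel Φ' W' (χ p) (mfderivModel n n χ p v) := by
  have hx := hcomp p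
  set x₀ := Φ p with hx₀
  set x₀' := Φ' (χ p) with hx₀'
  set F := chartMap (d := d) φ x₀ x₀' with hF
  set y₀ := extChartAt (𝓡 d) x₀ x₀ with hy₀
  have hφd : MDifferentiableAt (𝓡 d) (𝓡 d) φ (Φ p) := φ.contMDiff.mdifferentiableAt (by simp)
  have hdΦ : mfderivModel n d Φ' (χ p) (mfderivModel n n χ p v) =
      mfderivModel d d φ x₀ (mfderivModel n d Φ p v) :=
    (mfderivModel_comp_eq_comp hφd hΦ hΦ' hχ hcomp v).symm
  -- The components of `W'` are `dF` applied to those of `W`, with `dF` taken at a moving base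
  -- point; differentiating therefore produces a `D²F` term.
  have hloc : chartComponents Φ' W' x₀' ∘ χ =ᶠ[nhds p]
      fun q ↦ fderiv ℝ F (extChartAt (𝓡 d) x₀ (Φ q)) (chartComponents Φ W x₀ q) := by
    filter_upwards [hΦ.continuousAt.eventually
      (eventually_chartD_mfderiv φ.contMDiff hx)] with q hq
    rw [chartComponents, ← hq (W q)]
    let C : M' → EuclideanSpace ℝ (Fin d) →L[ℝ] EuclideanSpace ℝ (Fin d) := fun x ↦ chartD x₀' x
    change C (Φ' (χ q)) (W' (χ q)) = C (φ (Φ q)) (mfderivModel d d φ (Φ q) (W q))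
    rw [hcomp, hWW']
  have hF2 : HasFDerivAt (fderiv ℝ F) (fderiv ℝ (fderiv ℝ F) y₀) y₀ :=
    ((((contDiffAt_chartMap φ.contMDiff hx).of_le (n := ∞) (m := 2)
      (by norm_cast)).fderiv_right (m := 1) (by norm_num)).differentiableAt (by simp)).hasFDerivAt
  have hc : HasMFDerivAt (𝓡 n) 𝓘(ℝ, EuclideanSpace ℝ (Fin d))
      (extChartAt (𝓡 d) x₀ ∘ Φ) p (mfderivModel n d Φ p) := by
    have h1 : MDifferentiableAt (𝓡 d) 𝓘(ℝ, EuclideanSpace ℝ (Fin d)) (extChartAt (𝓡 d) x₀) (Φ p) :=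
      mdifferentiableAt_extChartAt (mem_chart_source _ _)
    have h2 := (h1.comp p hΦ).hasMFDerivAt
    have h3 : mfderivModel n d (extChartAt (𝓡 d) x₀ ∘ Φ) p = mfderivModel n d Φ p := by
      rw [mfderivModel_comp h1 hΦ]
      ext1 t
      exact chartD_self x₀ _
    exact h3 ▸ h2
  have hpair : HasMFDerivAt (𝓡 n) 𝓘(ℝ, EuclideanSpace ℝ (Fin d) × EuclideanSpace ℝ (Fin d))
      (fun q ↦ (extChartAt (𝓡 d) x₀ (Φ q), chartComponents Φ W x₀ q)) p
      ((mfderivModel n d Φ p).prod (mfderivModel n d (chartComponents Φ W x₀) p)) :=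
    ⟨hc.1.prodMk hW.hasMFDerivAt.1, hc.2.prodMk hW.hasMFDerivAt.2⟩
  have hev : HasFDerivAt (fun z : EuclideanSpace ℝ (Fin d) × EuclideanSpace ℝ (Fin d) ↦
      fderiv ℝ F z.1 z.2) _ (y₀, chartComponents Φ W x₀ p) :=
    (HasFDerivAt.comp (g := fderiv ℝ F) (y₀, chartComponents Φ W x₀ p) hF2
      hasFDerivAt_fst).clm_apply hasFDerivAt_snd
  have hder := HasMFDerivAt.comp p (g := fun z : EuclideanSpace ℝ (Fin d) ×
    EuclideanSpace ℝ (Fin d) ↦ fderiv ℝ F z.1 z.2) hev.hasMFDerivAt hpair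
  have hderv : mfderivModel n d (chartComponents Φ' W' x₀' ∘ χ) p v =
      fderiv ℝ F y₀ (mfderivModel n d (chartComponents Φ W x₀) p v) +
        fderiv ℝ (fderiv ℝ F) y₀ (mfderivModel n d Φ p v) (chartComponents Φ W x₀ p) := by
    rw [mfderivModel_congr hloc]
    exact congrArg (fun L ↦ L v) hder.mfderiv
  rw [mfderivModel_comp hW' hχ, fderiv_chartMap_eq_mfderiv hx] at hderv
  have hWp : chartComponents Φ W x₀ p = W p := chartD_self _ _
  rw [hWp] at hderv
  -- The `D²F` term of the Christoffel law is exactly the one produced by the product rule in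
  -- `hderv`, so the two balance.
  have hC := hφ.mfderiv_christoffel hx (mfderivModel n d Φ p v) (W p)
  rw [g.covDerivModel_eq, g'.covDerivModel_eq, map_add, ← hx₀, ← hx₀', hdΦ, ← hWW' p]
  refine (congrArg₂ (· + ·) rfl hC).trans ?_
  change _ = (mfderivModel n d (chartComponents Φ' W' x₀') (χ p)).comp (mfderivModel n n χ p) v + _
  rw [hderv]
  abel

end Naturality

/-! ### Restricting a diffeomorphism to embedded submanifolds. -/

section Lifting

variable {n d : ℕ} {S : Type*} [TopologicalSpace S] [ChartedSpace (EuclideanSpace ℝ (Fin n)) S]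
  {S' : Type*} [TopologicalSpace S'] [ChartedSpace (EuclideanSpace ℝ (Fin n)) S']
  {M : Type*} [TopologicalSpace M] [ChartedSpace (EuclideanSpace ℝ (Fin d)) M]
  {M' : Type*} [TopologicalSpace M'] [ChartedSpace (EuclideanSpace ℝ (Fin d)) M']

/-- The topological embedding gives continuity of `f`; for continuous `f`, smoothness can be tested
after composing with an immersion. -/
theorem Manifold.IsSmoothEmbedding.contMDiff_of_comp {Φ' : S' → M'}
    (hΦ' : Manifold.IsSmoothEmbedding (𝓡 n) (𝓡 d) ∞ Φ') {f : S → S'}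
    (hf : ContMDiff (𝓡 n) (𝓡 d) ∞ (Φ' ∘ f)) : ContMDiff (𝓡 n) (𝓡 n) ∞ f :=
  (ContMDiff.iff_comp_isImmersion hΦ'.isImmersion).mpr
    ⟨hΦ'.isEmbedding.continuous_iff.mpr hf.continuous, hf⟩

/-- A diffeomorphism between ambient manifolds that maps one embedded submanifold onto another
restricts to a diffeomorphism of the submanifolds. -/
theorem Diffeomorph.exists_restrict (φ : M ≃ₘ^∞⟮𝓡 d, 𝓡 d⟯ M') {Φ : S → M} {Φ' : S' → M'}
    (hΦ : Manifold.IsSmoothEmbedding (𝓡 n) (𝓡 d) ∞ Φ)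
    (hΦ' : Manifold.IsSmoothEmbedding (𝓡 n) (𝓡 d) ∞ Φ')
    (himage : φ '' Set.range Φ = Set.range Φ') :
    ∃ χ : S ≃ₘ^∞⟮𝓡 n, 𝓡 n⟯ S', ∀ q, φ (Φ q) = Φ' (χ q) := by
  have h1 : ∀ q, ∃ q', Φ' q' = φ (Φ q) := fun q ↦ by
    have : φ (Φ q) ∈ Set.range Φ' := himage ▸ Set.mem_image_of_mem φ (Set.mem_range_self q)
    exact this
  have h2 : ∀ q', ∃ q, φ (Φ q) = Φ' q' := fun q' ↦ by
    obtain ⟨_, ⟨q, rfl⟩, hq⟩ : Φ' q' ∈ φ '' Set.range Φ := himage ▸ Set.mem_range_self q'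
    exact ⟨q, hq⟩
  choose f hf using h1
  choose f' hf' using h2
  have e1 : Φ' ∘ f = φ ∘ Φ := funext hf
  have e2 : Φ ∘ f' = φ.symm ∘ Φ' := funext fun q' ↦ by
    rw [Function.comp_apply, Function.comp_apply, ← hf', φ.symm_apply_apply]
  refine ⟨⟨⟨f, f', fun q ↦ ?_, fun q' ↦ ?_⟩, ?_, ?_⟩, fun q ↦ (hf q).symm⟩
  · exact hΦ.isEmbedding.injective (φ.injective ((hf' _).trans (hf q)))
  · exact hΦ'.isEmbedding.injective ((hf _).trans (hf' q'))
  · exact hΦ'.contMDiff_of_comp (e1 ▸ φ.contMDiff.comp hΦ.contMDiff)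
  · exact hΦ.contMDiff_of_comp (e2 ▸ φ.symm.contMDiff.comp hΦ'.contMDiff)

end Lifting

/-! ### Construction of the gauge parameters. -/

namespace HorizonTuple

variable {n : ℕ} {S : Type*} [TopologicalSpace S] [ChartedSpace (EuclideanSpace ℝ (Fin n)) S]
  [IsManifold (𝓡 n) ∞ S]

theorem smooth_etaBar {k : HorizonTuple n S} (hk : k.IsNullMetricData)
    (hα : ContMDiff (𝓡 n) 𝓘(ℝ, ℝ) ∞ k.alpha) : k.etaBar.Smooth := by
  refine hk.smooth_of_ambientForm (a := 0) (f := k.alpha) (θ := fun _ ↦ 0)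
    (fun p w ↦ ?_) (fun q₀ u ↦ ?_) hα
  · simp [ambientForm_apply, etaBar, gam_normal hk, ell_normal hk]
  · simpa using! contMDiffAt_const

/-- Two riggings of null data with the same tensor `γ` are related by gauge parameters. -/
theorem exists_gauge {k : HorizonTuple n S} (hk : k.IsNullMetricData) (θ : OneForm n S)
    {f : S → ℝ} (hf : ContMDiff (𝓡 n) 𝓘(ℝ, ℝ) ∞ f)
    (hθ : ∀ (X : VField n S) (q₀ : S), ContMDiffAt (𝓡 n) (𝓡 n).tangent ∞
        (fun q ↦ (⟨q, X q⟩ : TangentBundle (𝓡 n) S)) q₀ →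
      ContMDiffAt (𝓡 n) 𝓘(ℝ, ℝ) ∞ (fun q ↦ θ q (X q)) q₀)
    (hz : ∀ p, θ p (k.normal p) ≠ 0) :
    ContMDiff (𝓡 n) 𝓘(ℝ, ℝ) ∞ (fun p ↦ θ p (k.normal p)) ∧ ∃ V : VField n S, V.Smooth ∧
      (∀ p, θ p = θ p (k.normal p) • (k.ell p + k.gam p (V p))) ∧
      ∀ p, f p = θ p (k.normal p) ^ 2 *
        (k.ell2 p + 2 * k.ell p (V p) + k.gam p (V p) (V p)) := by
  have hzs : ContMDiff (𝓡 n) 𝓘(ℝ, ℝ) ∞ (fun p ↦ θ p (k.normal p)) := fun q ↦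
    hθ _ q (smooth_normal hk q)
  refine ⟨hzs, ?_⟩
  set z : S → ℝ := fun p ↦ θ p (k.normal p)
  have hzi : ContMDiff (𝓡 n) 𝓘(ℝ, ℝ) ∞ (fun p ↦ (z p)⁻¹) := fun q ↦
    (contDiffAt_inv ℝ (hz q)).contMDiffAt.comp q (hzs q)
  let β : OneForm n S := fun p ↦ (z p)⁻¹ • θ p - k.ell p
  have hβs : ∀ q₀ u, ContMDiffAt (𝓡 n) 𝓘(ℝ, ℝ) ∞ (fun q ↦ β q (frameField q₀ u q)) q₀ := by
    intro q₀ u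
    exact ((hzi q₀).mul (hθ _ q₀ (contMDiffAt_frameField q₀ u))).sub
      (hk.ell_smooth.contMDiffAt_apply contMDiffAt_id (contMDiffAt_frameField q₀ u))
  have hβn : ∀ p, β p (k.normal p) = 0 := by
    intro p
    have : (z p)⁻¹ * z p - k.ell p (k.normal p) = 0 := by
      rw [inv_mul_cancel₀ (hz p), ell_normal hk, sub_self]
    exact this
  have hsolve : ∀ p, ∃ X : TangentSpace (𝓡 n) p, ∀ w, k.ambientForm p (X, 0) w = β p w.1 := by
    intro p
    let u := (LinearMap.BilinForm.toDual (k.ambientForm p) (hk.nondegenerate p)).symm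
      ((β p).toLinearMap.comp (LinearMap.fst ℝ _ _))
    have hu : ∀ w, k.ambientForm p u w = β p w.1 := fun w ↦
      LinearMap.BilinForm.apply_toDual_symm_apply ..
    -- Pairing `u` with `(n, 0)` gives `u.2`, since `γ(·, n) = 0` and `ℓ(n) = 1`; the right-hand
    -- side there is `β(n) = 0`.
    have hu2 : u.2 = 0 := by
      have h1 := hu (k.normal p, 0)
      rw [ambientForm_apply] at h1
      simp only [hβn, ell_normal hk, hk.gam_symm p u.1, gam_normal hk] at h1
      simpa using h1
    refine ⟨u.1, fun w ↦ ?_⟩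
    rw [← hu, ← hu2]
  obtain ⟨V₀, hV₀⟩ : ∃ V₀ : VField n S, ∀ p w, k.ambientForm p (V₀ p, 0) w = β p w.1 :=
    ⟨fun p ↦ (hsolve p).choose, fun p ↦ (hsolve p).choose_spec⟩
  have hV₀s : V₀.Smooth := hk.smooth_of_ambientForm (a := 0) (f := 0) (θ := β)
    (fun p w ↦ by simpa using hV₀ p w) hβs contMDiff_const
  have hV₀β : ∀ p w, k.gam p (V₀ p) w = β p w := fun p w ↦ by
    simpa [ambientForm_apply] using hV₀ p (w, 0)
  have hV₀ell : ∀ p, k.ell p (V₀ p) = 0 := fun p ↦ by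
    simpa [ambientForm_apply] using hV₀ p (0, 1)
  -- With `ℓ(V₀) = 0`, the field `V₀ + c n` has `ℓ`-value `c` and the same `γ(V, ·)` and `γ(V, V)`;
  -- this `c` solves the scalar equation, which is linear in it.
  let c : S → ℝ := fun p ↦
    2⁻¹ * ((z p)⁻¹ * ((z p)⁻¹ * f p) - k.ell2 p - k.gam p (V₀ p) (V₀ p))
  have hc : ContMDiff (𝓡 n) 𝓘(ℝ, ℝ) ∞ c := fun q ↦
    contMDiffAt_const.mul ((((hzi q).mul ((hzi q).mul (hf q))).sub (hk.ell2_smooth q)).sub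
      (hk.gam_smooth.contMDiffAt_apply (hV₀s q) (hV₀s q)))
  refine ⟨fun p ↦ V₀ p + c p • k.normal p, ?_, fun p ↦ ?_, fun p ↦ ?_⟩
  · refine hk.smooth_of_ambientForm (a := 0) (f := c) (θ := β) (fun p w ↦ ?_) hβs hc
    simp [ambientForm_apply, gam_normal hk, ell_normal hk, hV₀β, hV₀ell]
  · ext w
    have h1 : β p w = (z p)⁻¹ * θ p w - k.ell p w := rfl
    have h2 : z p * (z p)⁻¹ = 1 := mul_inv_cancel₀ (hz p)
    have h3 : θ p w = θ p (k.normal p) * (k.ell p w + β p w) := by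
      rw [h1]; linear_combination -(θ p w * h2)
    simpa [gam_normal hk, hV₀β, mul_add] using h3
  · have h0 : k.gam p (V₀ p) (k.normal p) = 0 := by rw [hV₀β, hβn]
    simp only [map_add, map_smul, add_apply, smul_apply, gam_normal hk,
      ell_normal hk, hV₀ell, h0, smul_eq_mul]
    have := hz p
    change z p ≠ 0 at this
    change f p = z p ^ 2 * _
    simp only [c]
    field_simp
    ring

end HorizonTuple

/-! ### Embedded data in model-space form. -/

namespace HorizonTuple

variable {n : ℕ} {S : Type*} [TopologicalSpace S] [ChartedSpace (EuclideanSpace ℝ (Fin n)) S]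
  {M : Type*} [TopologicalSpace M] [ChartedSpace (EuclideanSpace ℝ (Fin (n + 1))) M]
  [IsManifold (𝓡 (n + 1)) ∞ M]

theorem IsEmbeddedIn.gam_eq_model {k : HorizonTuple n S} {g : SemiRiemannianMetric (n + 1) M}
    {Φ : S → M} {ξ : ∀ p : S, TangentSpace (𝓡 (n + 1)) (Φ p)} (h : k.IsEmbeddedIn g Φ ξ) (p : S)
    (v w : TangentSpace (𝓡 n) p) : k.gam p v w =
      g.model (Φ p) (mfderivModel n (n + 1) Φ p v) (mfderivModel n (n + 1) Φ p w) :=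
  congrArg (fun B ↦ B v w) (h.gam_eq p)

theorem IsEmbeddedIn.ell_eq_model {k : HorizonTuple n S} {g : SemiRiemannianMetric (n + 1) M}
    {Φ : S → M} {ξ : ∀ p : S, TangentSpace (𝓡 (n + 1)) (Φ p)} (h : k.IsEmbeddedIn g Φ ξ) (p : S)
    (v : TangentSpace (𝓡 n) p) :
    k.ell p v = g.model (Φ p) (ξ p) (mfderivModel n (n + 1) Φ p v) :=
  congrArg (fun B ↦ B v) (h.ell_eq p)

theorem IsEmbeddedIn.covDerivModel_eta {k : HorizonTuple n S}
    {g : SemiRiemannianMetric (n + 1) M} {Φ : S → M}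
    {ξ : ∀ p : S, TangentSpace (𝓡 (n + 1)) (Φ p)} (h : k.IsEmbeddedIn g Φ ξ) (p : S)
    (v : EuclideanSpace ℝ (Fin n)) :
    g.covDerivModel Φ (fun q ↦ mfderiv (𝓡 n) (𝓡 (n + 1)) Φ q (k.etaBar q)) p v =
      mfderivModel n (n + 1) Φ p (k.tau p v • k.normal p) :=
  (h.cov_eta p v).trans (map_smul (mfderiv (𝓡 n) (𝓡 (n + 1)) Φ p) (k.tau p v) (k.normal p)).symm

variable [IsManifold (𝓡 n) ∞ S]

theorem eq_zero_of_gam_of_ell {k : HorizonTuple n S} (hk : k.IsNullMetricData) {p : S}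
    {v : TangentSpace (𝓡 n) p} (hv : ∀ w, k.gam p v w = 0) (hl : k.ell p v = 0) : v = 0 := by
  have h : (v, (0 : ℝ)) = 0 :=
    (hk.nondegenerate p).1 _ fun w ↦ by simp [ambientForm_apply, hv, hl]
  exact congrArg Prod.fst h

/-- As `γ` and `ℓ` are induced through `dΦ`, a vector in its kernel is killed by both, hence
vanishes. -/
theorem IsEmbeddedIn.mfderivModel_injective {k : HorizonTuple n S} (hk : k.IsNullMetricData)
    {g : SemiRiemannianMetric (n + 1) M} {Φ : S → M}
    {ξ : ∀ p : S, TangentSpace (𝓡 (n + 1)) (Φ p)} (h : k.IsEmbeddedIn g Φ ξ) (p : S) :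
    Function.Injective (mfderivModel n (n + 1) Φ p) := by
  rw [injective_iff_map_eq_zero]
  intro v hv
  refine eq_zero_of_gam_of_ell hk (p := p) (fun w ↦ ?_) ?_
  · refine (h.gam_eq_model p v w).trans ?_
    rw [hv, map_zero]; rfl
  · refine (h.ell_eq_model p v).trans ?_
    rw [hv, map_zero]

theorem IsEmbeddedIn.mdifferentiableAt_components {k : HorizonTuple n S} (hk : k.IsAKHData)
    {g : SemiRiemannianMetric (n + 1) M} {Φ : S → M}
    {ξ : ∀ p : S, TangentSpace (𝓡 (n + 1)) (Φ p)} (h : k.IsEmbeddedIn g Φ ξ) (p : S) :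
    MDifferentiableAt (𝓡 n) 𝓘(ℝ, EuclideanSpace ℝ (Fin (n + 1)))
      (chartComponents Φ (fun q ↦ mfderiv (𝓡 n) (𝓡 (n + 1)) Φ q (k.etaBar q)) (Φ p)) p :=
  mdifferentiableAt_chartComponents
    ((h.embedding.contMDiff.contMDiff_tangentMap (m := ∞) le_rfl).comp
      (smooth_etaBar hk.nullData hk.alpha_smooth)) p

end HorizonTuple

end

/-! ### The proposition. -/

theorem mainTheorem11 {n : ℕ}
    {S : Type*} [TopologicalSpace S] [T2Space S] [SecondCountableTopology S] [ConnectedSpace S]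
    [ChartedSpace (EuclideanSpace ℝ (Fin n)) S] [IsManifold (𝓡 n) ∞ S]
    {S' : Type*} [TopologicalSpace S'] [T2Space S'] [SecondCountableTopology S']
    [ConnectedSpace S'] [ChartedSpace (EuclideanSpace ℝ (Fin n)) S'] [IsManifold (𝓡 n) ∞ S']
    {M : Type*} [TopologicalSpace M] [T2Space M] [SecondCountableTopology M] [ConnectedSpace M]
    [ChartedSpace (EuclideanSpace ℝ (Fin (n + 1))) M] [IsManifold (𝓡 (n + 1)) ∞ M]
    {M' : Type*} [TopologicalSpace M'] [T2Space M'] [SecondCountableTopology M']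
    [ConnectedSpace M'] [ChartedSpace (EuclideanSpace ℝ (Fin (n + 1))) M']
    [IsManifold (𝓡 (n + 1)) ∞ M']
    (g : SemiRiemannianMetric (n + 1) M) (g' : SemiRiemannianMetric (n + 1) M')
    (k : HorizonTuple n S) (k' : HorizonTuple n S')
    (hk : k.IsAKHData) (hk' : k'.IsAKHData)
    (Φ : S → M) (ξ : ∀ p : S, TangentSpace (𝓡 (n + 1)) (Φ p)) (hΦ : k.IsEmbeddedIn g Φ ξ)
    (Φ' : S' → M') (ξ' : ∀ p : S', TangentSpace (𝓡 (n + 1)) (Φ' p))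
    (hΦ' : k'.IsEmbeddedIn g' Φ' ξ')
    (φ : M ≃ₘ^∞⟮𝓡 (n + 1), 𝓡 (n + 1)⟯ M') (hφ : IsSemiRiemannianIsometry g g' φ)
    (himage : φ '' Set.range Φ = Set.range Φ')
    (heta : ∀ (p : S) (p' : S'), φ (Φ p) = Φ' p' →
      tangentMap (𝓡 (n + 1)) (𝓡 (n + 1)) φ
          (tangentMap (𝓡 n) (𝓡 (n + 1)) Φ ⟨p, k.etaBar p⟩) =
        tangentMap (𝓡 n) (𝓡 (n + 1)) Φ' ⟨p', k'.etaBar p'⟩) :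
    ∃ (χ : S ≃ₘ^∞⟮𝓡 n, 𝓡 n⟯ S') (z : S → ℝ) (V : VField n S),
      ContMDiff (𝓡 n) 𝓘(ℝ, ℝ) ∞ z ∧ (∀ p, z p ≠ 0) ∧ V.Smooth ∧
        HorizonTuple.pullback χ k' = k.gauge z V := by
  obtain ⟨χ, hχ⟩ := φ.exists_restrict hΦ.embedding hΦ'.embedding himage
  have dφ : ∀ x, MDifferentiableAt (𝓡 (n + 1)) (𝓡 (n + 1)) φ x :=
    φ.contMDiff.mdifferentiable (by simp)
  have dΦ := hΦ.embedding.contMDiff.mdifferentiable (by simp)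
  have dΦ' := hΦ'.embedding.contMDiff.mdifferentiable (by simp)
  have dχ : ∀ x, MDifferentiableAt (𝓡 n) (𝓡 n) χ x := χ.contMDiff.mdifferentiable (by simp)
  have hD : ∀ p v, mfderivModel (n + 1) (n + 1) φ (Φ p) (mfderivModel n (n + 1) Φ p v) =
      mfderivModel n (n + 1) Φ' (χ p) (mfderivModel n n χ p v) := fun p v ↦
    mfderivModel_comp_eq_comp (dφ _) (dΦ p) (dΦ' _) (dχ p) hχ v
  let D : ∀ p, TangentSpace (𝓡 n) p →L[ℝ] TangentSpace (𝓡 n) (χ p) := fun p ↦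
    mfderiv (𝓡 n) (𝓡 n) χ p
  have hgam : ∀ p v w, k'.gam (χ p) (D p v) (D p w) = k.gam p v w := by
    intro p v w
    have h : ∀ a b : EuclideanSpace ℝ (Fin n),
        g'.model (Φ' (χ p)) (mfderivModel n (n + 1) Φ' (χ p) (mfderivModel n n χ p a))
            (mfderivModel n (n + 1) Φ' (χ p) (mfderivModel n n χ p b)) =
          g.model (Φ p) (mfderivModel n (n + 1) Φ p a) (mfderivModel n (n + 1) Φ p b) := by
      intro a b
      rw [← hD, ← hD, ← hχ]
      exact congrArg (fun B ↦ B (mfderivModel n (n + 1) Φ p a) (mfderivModel n (n + 1) Φ p b))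
        (hφ (Φ p))
    exact (hΦ'.gam_eq_model _ _ _).trans ((h v w).trans (hΦ.gam_eq_model p v w).symm)
  have hsurj : ∀ p, Function.Surjective (D p) := fun p ↦
    (χ.mfderivToContinuousLinearEquiv (by simp) p).surjective
  have hinj : ∀ p, Function.Injective (D p) := fun p ↦
    (χ.mfderivToContinuousLinearEquiv (by simp) p).injective
  have hdn : ∀ p w, k'.gam (χ p) (D p (k.normal p)) w = 0 := by
    intro p w
    obtain ⟨w, rfl⟩ := hsurj p w
    exact (hgam p _ w).trans (HorizonTuple.gam_normal hk.nullData p w)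
  -- `dχ(n)` lies in the radical of `γ'`; were `ℓ'` also zero on it, `n` would vanish, contradicting
  -- `ℓ(n) = 1`.
  have hz : ∀ p, k'.ell (χ p) (D p (k.normal p)) ≠ 0 := by
    intro p h0
    have h1 : D p (k.normal p) = 0 :=
      HorizonTuple.eq_zero_of_gam_of_ell hk'.nullData (hdn p) h0
    have h2 : k.normal p = 0 := (injective_iff_map_eq_zero _).mp (hinj p) _ h1
    have h3 := HorizonTuple.ell_normal hk.nullData p
    rw [h2, map_zero] at h3
    exact zero_ne_one h3
  obtain ⟨hzs, V, hV, hell, hell2⟩ := HorizonTuple.exists_gauge hk.nullData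
    (fun p ↦ (k'.ell (χ p)).comp (D p)) (hk'.nullData.ell2_smooth.comp χ.contMDiff)
    (fun X q₀ hX ↦ hk'.nullData.ell_smooth.contMDiffAt_apply χ.contMDiff.contMDiffAt
      ((χ.contMDiff.contMDiff_tangentMap (m := ∞) le_rfl).contMDiffAt.comp q₀ hX)) hz
  let z : S → ℝ := fun p ↦ k'.ell (χ p) (D p (k.normal p))
  have hn' : ∀ p, D p (k.normal p) = z p • k'.normal (χ p) := by
    intro p
    have h : (z p)⁻¹ • D p (k.normal p) = k'.normal (χ p) := by
      refine HorizonTuple.eq_normal_of hk'.nullData (χ p) (fun w ↦ ?_) ?_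
      · simp [hdn]
      · rw [map_smul]
        exact inv_mul_cancel₀ (hz p)
    rw [← h, smul_smul, mul_inv_cancel₀ (hz p), one_smul]
  have heta' : ∀ p, mfderivModel (n + 1) (n + 1) φ (Φ p)
      (mfderivModel n (n + 1) Φ p (k.etaBar p)) =
        mfderivModel n (n + 1) Φ' (χ p) (k'.etaBar (χ p)) := fun p ↦
    congrArg (fun t : TangentBundle (𝓡 (n + 1)) M' ↦ (t.2 : EuclideanSpace ℝ (Fin (n + 1))))
      (heta p (χ p) (hχ p))
  have halpha : ∀ p, k'.alpha (χ p) = z p * k.alpha p := by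
    intro p
    have h1 : D p (k.alpha p • k.normal p) = k'.alpha (χ p) • k'.normal (χ p) :=
      hΦ'.mfderivModel_injective hk'.nullData _ ((hD p _).symm.trans (heta' p))
    have h2 := congrArg (k'.ell (χ p)) h1
    rw [map_smul, hn', map_smul, map_smul, map_smul,
      HorizonTuple.ell_normal hk'.nullData] at h2
    simp only [smul_eq_mul, mul_one] at h2
    rw [← h2, mul_comm]
  have htau : ∀ p v, k'.tau (χ p) (D p v) = z p * k.tau p v := by
    intro p v
    have h1 := hφ.mfderiv_covDerivAlong (dΦ p) (dΦ' (χ p)) (dχ p) hχ heta'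
      (hΦ.mdifferentiableAt_components hk p) (hΦ'.mdifferentiableAt_components hk' (χ p)) v
    have h1' := (congrArg (mfderivModel (n + 1) (n + 1) φ (Φ p))
      (hΦ.covDerivModel_eta p v)).symm.trans (h1.trans (hΦ'.covDerivModel_eta (χ p) _))
    -- The ambient identity between covariant derivatives is one between images under `dΦ'`, so
    -- injectivity brings it down to the hypersurface, where `ℓ'` reads off the coefficients.
    have h2 : D p (k.tau p v • k.normal p) = k'.tau (χ p) (D p v) • k'.normal (χ p) :=
      hΦ'.mfderivModel_injective hk'.nullData _ ((hD p _).symm.trans h1')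
    have h3 := congrArg (k'.ell (χ p)) h2
    rw [map_smul, hn', map_smul, map_smul, map_smul,
      HorizonTuple.ell_normal hk'.nullData] at h3
    simp only [smul_eq_mul, mul_one] at h3
    rw [← h3, mul_comm]
  refine ⟨χ, z, V, hzs, hz, hV, ?_⟩
  apply HorizonTuple.ext
  · funext p
    exact ContinuousLinearMap.ext fun v ↦ ContinuousLinearMap.ext fun w ↦ hgam p v w
  · exact funext hell
  · exact funext hell2
  · funext p
    exact ContinuousLinearMap.ext fun v ↦ htau p v
  · exact funext halpha
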